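/- Let $\mathbb T=\mathbb R/2\pi\mathbb Z$, $\mathcal H=L^2([0,\pi]\times\mathbb T)$ with norm $\|\cdot\|$, $u^+=\max\{u,0\}$, $u^-=u^+-u$, and $\Box=\partial_t^2-\partial_s^2$. For integers $m\ge 1$, $n\ge 0$ put $\phi_{(m,n)}=\frac{\sqrt2}{\pi}\sin(ms)\cos(nt)$, $\psi_{(m,n)}=\frac{\sqrt2}{\pi}\sin(ms)\sin(nt)$; these are eigenfunctions of $\Box$ (with $u=0$ at $s=0,\pi$) for the eigenvalue $m^2-n^2$. Let $\dots<\lambda_{-1}<\lambda_0=0<\lambda_1<\dots$ be the increasing enumeration of the set $\{m^2-n^2: m\ge1,\ n\ge0\}$. Let $\mathcal R$ be the closed linear span in $\mathcal H$ of the $\phi_{(m,n)},\psi_{(m,n)}$ with $m\ne n$, $\mathcal N$ the closed linear span of those with $m=n$, and let $\mathcal H^1$ be the space of all $x\in\mathcal R\cap H^1([0,\pi]\times\mathbb T)$ with zero trace on $s=0$ and $s=\pi$, with the $H^1$ norm. Fix an integer $k$ with $\lambda_k\ne0$. **The curve $\mathcal D_k$.** Let $0<\varepsilon_3<\lambda_{k+1}-\lambda_k$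 and $0<\varepsilon_4<\frac1{\lambda_{k+1}-\lambda_k-\varepsilon_3}-\max\{0,\frac1{\lambda_{k+1}-\varepsilon_3}\}$, and set $\rho=\max\{0,\frac1{\lambda_{k+1}-\varepsilon_3}\}+\varepsilon_4$. Let $M:\mathcal H\to\mathcal H$ be the bounded operator with $M\phi_{(m,n)}=\frac{\phi_{(m,n)}}{\lambda_{k+1}-\varepsilon_3-m^2+n^2}$ and $M\psi_{(m,n)}=\frac{\psi_{(m,n)}}{\lambda_{k+1}-\varepsilon_3-m^2+n^2}$ for all $m\ge1$, $n\ge0$. For $r>0$ let $$\tilde a(r)=\sup_{0\ne v\in\mathcal H}\frac{\langle (M-\rho)v,v\rangle}{\|v^+\|^2+r\|v^-\|^2}.$$ In the open square $R_k(\varepsilon_3,\varepsilon_4)=\,]\lambda_{k+1}-\varepsilon_3-\frac1\rho,\ \lambda_{k+1}-\varepsilon_3[^2$ the curve $\mathcal D_k$ is $$\Bigl\{\Bigl(\lambda_{k+1}-\varepsilon_3-\frac1{\tilde a(r)+\rho},\ \lambda_{k+1}-\varepsilon_3-\frac1{r\tilde a(r)+\rho}\Bigr): r>0\Bigr\},$$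 and a point of $R_k(\varepsilon_3,\varepsilon_4)$ is above $\mathcal D_k$ if it lies in the connected component of $R_k(\varepsilon_3,\varepsilon_4)\setminus\mathcal D_k$ that contains $]\lambda_k,\lambda_{k+1}-\varepsilon_3[^2$. Let $\tilde R_k=\,]-\infty,\lambda_{k+1}[^2$ if $\lambda_k<0$ and $\tilde R_k=\,]0,\lambda_{k+1}[^2$ if $\lambda_k>0$. These squares $R_k(\varepsilon_3,\varepsilon_4)$ exhaust $\tilde R_k$ as $\varepsilon_3,\varepsilon_4\to0$ and the curves in them agree on common squares; a point of $\tilde R_k$ is said to be above $\mathcal D_k$ if, for some admissible $\varepsilon_3,\varepsilon_4$, it belongs to $R_k(\varepsilon_3,\varepsilon_4)$ and is above $\mathcal D_k$ there. **Weak solutions.** For $a,b\in\mathbb R$ and continuous $p:[0,\pi]\times\mathbb T\times\mathbb R\to\mathbb R$ let $P(s,t,\xi)=\int_0^\xi p(s,t,\tau)\,d\tau$. A weak solution of $$\Box u=au^+-bu^-+p(s,t,u)\ \text{ in } ]0,\pi[\times\mathbb T,\qquad u(0,t)=u(\pi,t)=0,\tag{1}$$ is a function $u=x+y$ such that $(x,y)\in\mathcal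 H^1\times\mathcal N$ is a critical point of $$\mathcal I(x,y)=\tfrac12\bigl(\|x_s\|^2-\|x_t\|^2-a\|(x+y)^+\|^2-b\|(x+y)^-\|^2\bigr)-\iint_{[0,\pi]\times\mathbb T}P(s,t,x+y)\,ds\,dt .$$ **Theorem.** Let $(a,b)\in\tilde R_k$ lie above $\mathcal D_k$. Let $p:[0,\pi]\times\mathbb T\times\mathbb R\to\mathbb R$ be continuous with $\lim_{|u|\to\infty}p(s,t,u)/u=0$ uniformly in $(s,t)$, and suppose that (increasing and decreasing being understood in the wide sense): * (H1$'$) there is $\underline\varepsilon_0>0$ such that for each $(s,t)$ the function $u\mapsto au^+-bu^-+p(s,t,u)-(\lambda_{k+1}-\underline\varepsilon_0)u$ is decreasing; * (H2$'$) if $\lambda_k>0$, there is $\overline\varepsilon_0>0$ such that for each $(s,t)$ the function $u\mapsto au^+-bu^-+p(s,t,u)-\overline\varepsilon_0u$ is increasing; * (H3$'$) if $\lambda_k<0$, there is $\overline\varepsilon_0>0$ such that for each $(s,t)$ the function $u\mapsto p(s,t,u)+\frac1{\overline\varepsilon_0}u$ is increasing. Then problem (1) has a weak solution. -/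

import Mathlib

namespace WaveFucik

open MeasureTheory Real Filter Topology
open scoped ContDiff ENNReal

noncomputable section

/-! ## The strip `[0,π] × 𝕋` and the space `L²` on it -/

instance factTwoPiPos : Fact (0 < 2 * π) := ⟨Real.two_pi_pos⟩

/-- The circle `𝕋 = ℝ / 2πℤ`. -/
abbrev Circ : Type := AddCircle (2 * π)

/-- The closed strip `[0,π] × 𝕋`, with points `(s, t)`. -/
abbrev Strip : Type := Set.Icc (0 : ℝ) π × Circ

/-- Lebesgue measure `ds` on the interval `[0,π]`. -/
def intervalMeasure : Measure (Set.Icc (0 : ℝ) π) :=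
  Measure.comap (Subtype.val : Set.Icc (0 : ℝ) π → ℝ) volume

instance : IsFiniteMeasure intervalMeasure := by
  refine ⟨?_⟩
  rw [intervalMeasure,
    (MeasurableEmbedding.subtype_coe measurableSet_Icc).comap_apply]
  refine lt_of_le_of_lt (measure_mono (t := Set.Icc (0 : ℝ) π) ?_) measure_Icc_lt_top
  rintro _ ⟨x, -, rfl⟩
  exact x.2

/-- Lebesgue measure `ds dt` on the strip, of total mass `2π²`. -/
def stripMeasure : Measure Strip := intervalMeasure.prod (volume : Measure Circ)

instance : IsFiniteMeasure stripMeasure := by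
  unfold stripMeasure; infer_instance

/-- The real Hilbert space `L²([0,π] × 𝕋)`. -/
abbrev L2Strip : Type := Lp ℝ 2 stripMeasure

/-! ## Eigenfunctions and eigenvalues of the wave operator -/

/-- The function `(√2/π) sin(m s) cos(n t)`. -/
def phiFun (m n : ℕ) : C(Strip, ℝ) where
  toFun z := √2 / π * Real.sin (m * (z.1 : ℝ)) * (fourier (n : ℤ) z.2 : ℂ).re
  continuous_toFun := by fun_prop

/-- The function `(√2/π) sin(m s) sin(n t)`. -/
def psiFun (m n : ℕ) : C(Strip, ℝ) where
  toFun z := √2 / π * Real.sin (m * (z.1 : ℝ)) * (fourier (n : ℤ) z.2 : ℂ).im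
  continuous_toFun := by fun_prop

theorem fourier_coe_eq (n : ℤ) (t : ℝ) :
    (fourier n (t : Circ) : ℂ) = Complex.exp (((n * t : ℝ) : ℂ) * Complex.I) := by
  rw [fourier_coe_apply]
  congr 1
  have : (π : ℂ) ≠ 0 := by exact_mod_cast Real.pi_ne_zero
  push_cast
  field_simp

theorem phiFun_apply (m n : ℕ) (s : Set.Icc (0 : ℝ) π) (t : ℝ) :
    phiFun m n (s, (t : Circ)) = √2 / π * Real.sin (m * s) * Real.cos (n * t) := by
  simp only [phiFun, ContinuousMap.coe_mk]
  rw [fourier_coe_eq, Complex.exp_ofReal_mul_I_re]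
  simp

theorem psiFun_apply (m n : ℕ) (s : Set.Icc (0 : ℝ) π) (t : ℝ) :
    psiFun m n (s, (t : Circ)) = √2 / π * Real.sin (m * s) * Real.sin (n * t) := by
  simp only [psiFun, ContinuousMap.coe_mk]
  rw [fourier_coe_eq, Complex.exp_ofReal_mul_I_im]
  simp

/-- `φ_{(m,n)}` as an element of `L²`. -/
def phi (m n : ℕ) : L2Strip := ContinuousMap.toLp 2 stripMeasure ℝ (phiFun m n)

/-- `ψ_{(m,n)}` as an element of `L²`. -/
def psi (m n : ℕ) : L2Strip := ContinuousMap.toLp 2 stripMeasure ℝ (psiFun m n)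

/-- `z` is one of the eigenvalues `m² - n²`, `m ≥ 1`, `n ≥ 0`, of `□ = ∂_t² - ∂_s²`. -/
def IsWaveEigenvalue (z : ℤ) : Prop :=
  ∃ m n : ℕ, 1 ≤ m ∧ z = (m : ℤ) ^ 2 - (n : ℤ) ^ 2

/-- The increasing enumeration `… < λ₋₂ < λ₋₁ < λ₀ = 0 < λ₁ < λ₂ < …` of the eigenvalues:
`Nat.nth P k` is the `k`-th element (counted from `0`) of the set of natural numbers with
property `P`, and `0` is an eigenvalue. -/
def eigInt : ℤ → ℤ
  | Int.ofNat k => (Nat.nth (fun j : ℕ => IsWaveEigenvalue (j : ℤ)) k : ℤ)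
  | Int.negSucc k => -(Nat.nth (fun j : ℕ => IsWaveEigenvalue (-(j : ℤ))) (k + 1) : ℤ)

/-- The eigenvalue `λ_k` as a real number. -/
def eig (k : ℤ) : ℝ := (eigInt k : ℝ)

/-- The closed span `ℛ` of the eigenfunctions with `m ≠ n`. -/
def rangeSpace : Submodule ℝ L2Strip :=
  (Submodule.span ℝ
    {e | ∃ m n : ℕ, 1 ≤ m ∧ m ≠ n ∧ (e = phi m n ∨ e = psi m n)}).topologicalClosure

/-- The closed span `𝒩` of the eigenfunctions with `m = n`: the kernel of `□`. -/
def kernelSpace : Submodule ℝ L2Strip :=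
  (Submodule.span ℝ
    {e | ∃ l : ℕ, 1 ≤ l ∧ (e = phi l l ∨ e = psi l l)}).topologicalClosure

/-! ## The Sobolev space `ℋ¹` -/

/-- The inclusion `[0,π] × 𝕋 → ℝ × 𝕋`. -/
def incl (z : Strip) : ℝ × Circ := ((z.1 : ℝ), z.2)

/-- Smooth functions on `ℝ × 𝕋`. -/
def IsSmooth (f : ℝ × Circ → ℝ) : Prop :=
  ContDiff ℝ ∞ (fun q : ℝ × ℝ => f (q.1, (q.2 : Circ)))

/-- The partial derivative `∂f/∂s`. -/
def partialS (f : ℝ × Circ → ℝ) (q : ℝ × Circ) : ℝ :=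
  deriv (fun σ : ℝ => f (σ, q.2)) q.1

/-- The partial derivative `∂f/∂t`. -/
def partialT (f : ℝ × Circ → ℝ) (q : ℝ × Circ) : ℝ :=
  deriv (fun τ : ℝ => f (q.1, q.2 + (τ : Circ))) 0

/-- `xs` and `xt` are the weak partial derivatives of `x` in `]0,π[ × 𝕋`: the test functions
are the smooth functions with (compact) support in `]0,π[ × 𝕋`. -/
def HasWeakGradient (x xs xt : L2Strip) : Prop :=
  ∀ f : ℝ × Circ → ℝ, IsSmooth f → tsupport f ⊆ Set.Ioo (0 : ℝ) π ×ˢ Set.univ →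
    (∫ z, x z * partialS f (incl z) ∂stripMeasure = -∫ z, xs z * f (incl z) ∂stripMeasure) ∧
    (∫ z, x z * partialT f (incl z) ∂stripMeasure = -∫ z, xt z * f (incl z) ∂stripMeasure)

/-- The boundary condition `x(0,t) = x(π,t) = 0`, for `x` in `H¹` with weak derivative `xs`:
there is no boundary term in Green's formula
`∬ x f_s + ∬ x_s f = ∫_𝕋 [x(π,t) f(π,t) - x(0,t) f(0,t)] dt`, where now `f` is smooth up to the
boundary and not required to vanish there. -/
def HasZeroTrace (x xs : L2Strip) : Prop :=
  ∀ f : ℝ × Circ → ℝ, IsSmooth f →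
    ∫ z, x z * partialS f (incl z) ∂stripMeasure = -∫ z, xs z * f (incl z) ∂stripMeasure

theorem continuous_of_lift {g : ℝ × Circ → ℝ}
    (h : Continuous (fun q : ℝ × ℝ => g (q.1, (q.2 : Circ)))) : Continuous g := by
  have hq : IsOpenQuotientMap (Prod.map (id : ℝ → ℝ) (fun t : ℝ => (t : Circ))) :=
    IsOpenQuotientMap.id.prodMap QuotientAddGroup.isOpenQuotientMap_mk
  exact hq.isQuotientMap.continuous_iff.2 h

theorem IsSmooth.continuous {f : ℝ × Circ → ℝ} (hf : IsSmooth f) : Continuous f :=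
  continuous_of_lift (ContDiff.continuous hf)

theorem IsSmooth.continuous_partialS {f : ℝ × Circ → ℝ} (hf : IsSmooth f) :
    Continuous (partialS f) := by
  apply continuous_of_lift
  have hd := ContDiff.continuous_fderiv hf (by simp)
  have key : (fun q : ℝ × ℝ => partialS f (q.1, (q.2 : Circ))) = fun q : ℝ × ℝ =>
      fderiv ℝ (fun q : ℝ × ℝ => f (q.1, (q.2 : Circ))) q (1, 0) := by
    funext q
    have h1 : HasFDerivAt (fun q : ℝ × ℝ => f (q.1, (q.2 : Circ)))
        (fderiv ℝ (fun q : ℝ × ℝ => f (q.1, (q.2 : Circ))) q) q :=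
      ((ContDiff.differentiable hf (by simp)) q).hasFDerivAt
    have h2 : HasDerivAt (fun σ : ℝ => (σ, q.2)) ((1 : ℝ), (0 : ℝ)) q.1 :=
      (hasDerivAt_id q.1).prodMk (hasDerivAt_const q.1 q.2)
    exact (HasFDerivAt.comp_hasDerivAt (x := q.1) (f := fun σ : ℝ => (σ, q.2)) h1 h2).deriv
  rw [key]
  exact hd.clm_apply continuous_const

theorem IsSmooth.continuous_partialT {f : ℝ × Circ → ℝ} (hf : IsSmooth f) :
    Continuous (partialT f) := by
  apply continuous_of_lift
  have hd := ContDiff.continuous_fderiv hf (by simp)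
  have key : (fun q : ℝ × ℝ => partialT f (q.1, (q.2 : Circ))) = fun q : ℝ × ℝ =>
      fderiv ℝ (fun q : ℝ × ℝ => f (q.1, (q.2 : Circ))) q (0, 1) := by
    funext q
    have h1 : HasFDerivAt (fun q : ℝ × ℝ => f (q.1, (q.2 : Circ)))
        (fderiv ℝ (fun q : ℝ × ℝ => f (q.1, (q.2 : Circ))) q) (q.1, q.2 + 0) := by
      simpa using ((ContDiff.differentiable hf (by simp)) q).hasFDerivAt
    have h2 : HasDerivAt (fun τ : ℝ => (q.1, q.2 + τ)) ((0 : ℝ), (1 : ℝ)) 0 :=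
      (hasDerivAt_const (0 : ℝ) q.1).prodMk ((hasDerivAt_id (0 : ℝ)).const_add q.2)
    have h3 := (HasFDerivAt.comp_hasDerivAt (x := (0 : ℝ))
      (f := fun τ : ℝ => (q.1, q.2 + τ)) h1 h2).deriv
    rw [← h3]
    simp [partialT, Function.comp_def]
  rw [key]
  exact hd.clm_apply continuous_const

theorem continuous_incl : Continuous incl := by
  unfold incl; fun_prop

theorem integrable_mul_of_continuous (x : L2Strip) {g : ℝ × Circ → ℝ} (hg : Continuous g) :
    Integrable (fun z => x z * g (incl z)) stripMeasure := by
  have hg' : Continuous (fun z : Strip => g (incl z)) := hg.comp continuous_incl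
  have hx : Integrable (fun z => x z) stripMeasure := (Lp.memLp x).integrable (by norm_num)
  obtain ⟨C, hC⟩ := (isCompact_univ (X := Strip)).exists_bound_of_continuousOn hg'.continuousOn
  exact hx.mul_bdd (c := C) hg'.aestronglyMeasurable (ae_of_all _ fun z => hC z trivial)

theorem integral_add_mul (x y : L2Strip) {g : ℝ × Circ → ℝ} (hg : Continuous g) :
    ∫ z, (x + y : L2Strip) z * g (incl z) ∂stripMeasure =
      ∫ z, x z * g (incl z) ∂stripMeasure + ∫ z, y z * g (incl z) ∂stripMeasure := by
  rw [← integral_add (integrable_mul_of_continuous x hg) (integrable_mul_of_continuous y hg)]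
  refine integral_congr_ae ?_
  filter_upwards [Lp.coeFn_add x y] with z hz
  rw [hz, Pi.add_apply, add_mul]

theorem integral_smul_mul (c : ℝ) (x : L2Strip) (g : ℝ × Circ → ℝ) :
    ∫ z, (c • x : L2Strip) z * g (incl z) ∂stripMeasure =
      c * ∫ z, x z * g (incl z) ∂stripMeasure := by
  rw [← integral_const_mul]
  refine integral_congr_ae ?_
  filter_upwards [Lp.coeFn_smul c x] with z hz
  rw [hz, Pi.smul_apply, smul_eq_mul, mul_assoc]

/-- The space `ℋ¹` of the `x ∈ ℛ ∩ H¹([0,π] × 𝕋)` with `x = 0` for `s = 0` and `s = π`. An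
element is stored as the triple `(x, x_s, x_t)`, in which the weak derivatives are determined
by `x`; the norm inherited from `L² × L² × L²` is equivalent to the norm of `H¹`. -/
def sobolevSpace : Submodule ℝ (L2Strip × L2Strip × L2Strip) where
  carrier := {w | w.1 ∈ rangeSpace ∧ HasWeakGradient w.1 w.2.1 w.2.2 ∧ HasZeroTrace w.1 w.2.1}
  add_mem' := by
    rintro ⟨x, xs, xt⟩ ⟨y, ys, yt⟩ ⟨hx, hx', hx''⟩ ⟨hy, hy', hy''⟩
    refine ⟨rangeSpace.add_mem hx hy, fun f hf hs => ⟨?_, ?_⟩, fun f hf => ?_⟩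
    · have h1 := (hx' f hf hs).1
      have h2 := (hy' f hf hs).1
      simp only [Prod.mk_add_mk] at h1 h2 ⊢
      rw [integral_add_mul _ _ hf.continuous_partialS, integral_add_mul _ _ hf.continuous,
        h1, h2]
      ring
    · have h1 := (hx' f hf hs).2
      have h2 := (hy' f hf hs).2
      simp only [Prod.mk_add_mk] at h1 h2 ⊢
      rw [integral_add_mul _ _ hf.continuous_partialT, integral_add_mul _ _ hf.continuous,
        h1, h2]
      ring
    · have h1 := hx'' f hf
      have h2 := hy'' f hf
      simp only [Prod.mk_add_mk] at h1 h2 ⊢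
      rw [integral_add_mul _ _ hf.continuous_partialS, integral_add_mul _ _ hf.continuous,
        h1, h2]
      ring
  zero_mem' := by
    have h0 : ∀ g : ℝ × Circ → ℝ, ∫ z, (0 : L2Strip) z * g (incl z) ∂stripMeasure = 0 := by
      intro g
      simpa using integral_smul_mul 0 0 g
    have h1 : ∀ g₁ g₂ : ℝ × Circ → ℝ, ∫ z, (0 : L2Strip) z * g₁ (incl z) ∂stripMeasure =
        -∫ z, (0 : L2Strip) z * g₂ (incl z) ∂stripMeasure := by
      intro g₁ g₂
      rw [h0, h0, neg_zero]
    exact ⟨rangeSpace.zero_mem, fun f hf hs => ⟨h1 _ _, h1 _ _⟩, fun f hf => h1 _ _⟩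
  smul_mem' := by
    rintro c ⟨x, xs, xt⟩ ⟨hx, hx', hx''⟩
    refine ⟨rangeSpace.smul_mem c hx, fun f hf hs => ⟨?_, ?_⟩, fun f hf => ?_⟩
    · have h1 := (hx' f hf hs).1
      simp only [Prod.smul_mk] at h1 ⊢
      rw [integral_smul_mul, integral_smul_mul, h1]
      ring
    · have h1 := (hx' f hf hs).2
      simp only [Prod.smul_mk] at h1 ⊢
      rw [integral_smul_mul, integral_smul_mul, h1]
      ring
    · have h1 := hx'' f hf
      simp only [Prod.smul_mk] at h1 ⊢
      rw [integral_smul_mul, integral_smul_mul, h1]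
      ring

/-! ## Weak solutions of `□u = a u⁺ - b u⁻ + p(s,t,u)` -/

/-- The function `u = x + y` represented by a pair `(x, y) ∈ ℋ¹ × 𝒩`. -/
def toFunction (w : sobolevSpace × kernelSpace) : L2Strip :=
  (w.1 : L2Strip × L2Strip × L2Strip).1 + (w.2 : L2Strip)

/-- The energy functional on `ℋ¹ × 𝒩`,
`½ (‖x_s‖² - ‖x_t‖² - a ‖(x+y)⁺‖² - b ‖(x+y)⁻‖²) - ∬ P(s,t,(x+y)(s,t)) ds dt` with
`P(s,t,ξ) = ∫₀^ξ p(s,t,τ) dτ`. -/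
def energy (a b : ℝ) (p : Strip → ℝ → ℝ) (w : sobolevSpace × kernelSpace) : ℝ :=
  1 / 2 * (‖(w.1 : L2Strip × L2Strip × L2Strip).2.1‖ ^ 2
      - ‖(w.1 : L2Strip × L2Strip × L2Strip).2.2‖ ^ 2
      - a * ‖Lp.posPart (toFunction w)‖ ^ 2 - b * ‖Lp.negPart (toFunction w)‖ ^ 2)
    - ∫ z, (∫ τ in (0 : ℝ)..(toFunction w z), p z τ) ∂stripMeasure

/-- `w = (x, y)`, i.e. `u = x + y`, is a weak solution of `□u = a u⁺ - b u⁻ + p(s,t,u)` with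
`u(0,t) = u(π,t) = 0`: it is a critical point of the energy functional. -/
def IsWeakSolution (a b : ℝ) (p : Strip → ℝ → ℝ) (w : sobolevSpace × kernelSpace) : Prop :=
  HasFDerivAt (energy a b p) (0 : (sobolevSpace × kernelSpace) →L[ℝ] ℝ) w

/-! ## The curve `𝒟_k` -/

/-- The coefficient of `v` along the nonzero vector `e` of an orthogonal system (`0` if
`e = 0`). -/
def coeff (e v : L2Strip) : ℝ := inner ℝ e v / ‖e‖ ^ 2

/-- The operator `M = (-□ + c)⁻¹` given by
`M v = ∑ [α_{(m,n)} φ_{(m,n)} + β_{(m,n)} ψ_{(m,n)}] / (c - m² + n²)` for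
`v = ∑ [α_{(m,n)} φ_{(m,n)} + β_{(m,n)} ψ_{(m,n)}]`; here `m = i.1 + 1` and `n = i.2`. -/
def resolventOp (c : ℝ) (v : L2Strip) : L2Strip :=
  ∑' i : ℕ × ℕ, (c - ((i.1 + 1 : ℕ) : ℝ) ^ 2 + (i.2 : ℝ) ^ 2)⁻¹ •
    (coeff (phi (i.1 + 1) i.2) v • phi (i.1 + 1) i.2
      + coeff (psi (i.1 + 1) i.2) v • psi (i.1 + 1) i.2)

/-- The second shift `ρ = max {0, 1/(λ_{k+1} - ε₃)} + ε₄`. -/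
def rho (k : ℤ) (ε₃ ε₄ : ℝ) : ℝ := max 0 (1 / (eig (k + 1) - ε₃)) + ε₄

/-- The admissible parameters: `0 < ε₃ < λ_{k+1} - λ_k` and
`0 < ε₄ < 1/(λ_{k+1} - λ_k - ε₃) - max {0, 1/(λ_{k+1} - ε₃)}`. -/
def Admissible (k : ℤ) (ε₃ ε₄ : ℝ) : Prop :=
  (0 < ε₃ ∧ ε₃ < eig (k + 1) - eig k) ∧
    (0 < ε₄ ∧ ε₄ < 1 / (eig (k + 1) - eig k - ε₃) - max 0 (1 / (eig (k + 1) - ε₃)))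

/-- `ã(r) = sup_{v ≠ 0} ⟨(M - ρ) v, v⟩ / (‖v⁺‖² + r ‖v⁻‖²)`. -/
def aTilde (k : ℤ) (ε₃ ε₄ r : ℝ) : ℝ :=
  ⨆ v : {v : L2Strip // v ≠ 0},
    inner ℝ (resolventOp (eig (k + 1) - ε₃) v.1 - rho k ε₃ ε₄ • v.1) v.1 /
      (‖Lp.posPart v.1‖ ^ 2 + r * ‖Lp.negPart v.1‖ ^ 2)

/-- The open square `R_k = ]λ_{k+1} - ε₃ - 1/ρ, λ_{k+1} - ε₃[²`. -/
def squareR (k : ℤ) (ε₃ ε₄ : ℝ) : Set (ℝ × ℝ) :=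
  Set.Ioo (eig (k + 1) - ε₃ - 1 / rho k ε₃ ε₄) (eig (k + 1) - ε₃) ×ˢ
    Set.Ioo (eig (k + 1) - ε₃ - 1 / rho k ε₃ ε₄) (eig (k + 1) - ε₃)

/-- The part of the curve `𝒟_k` in `R_k`, parametrized by `r > 0`. -/
def curveD (k : ℤ) (ε₃ ε₄ : ℝ) : Set (ℝ × ℝ) :=
  {z | ∃ r : ℝ, 0 < r ∧
    z = (eig (k + 1) - ε₃ - 1 / (aTilde k ε₃ ε₄ r + rho k ε₃ ε₄),
      eig (k + 1) - ε₃ - 1 / (r * aTilde k ε₃ ε₄ r + rho k ε₃ ε₄))}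

/-- The points of `R_k` above `𝒟_k`: the connected component of `R_k \ 𝒟_k` that contains the
square `]λ_k, λ_{k+1} - ε₃[²`. -/
def aboveInSquare (k : ℤ) (ε₃ ε₄ : ℝ) : Set (ℝ × ℝ) :=
  {z | ∃ z₀ ∈ Set.Ioo (eig k) (eig (k + 1) - ε₃) ×ˢ Set.Ioo (eig k) (eig (k + 1) - ε₃),
    z ∈ connectedComponentIn (squareR k ε₃ ε₄ \ curveD k ε₃ ε₄) z₀}

/-- The square `R̃_k`: `]-∞, λ_{k+1}[²` if `λ_k < 0`, and `]0, λ_{k+1}[²` if `λ_k > 0`. -/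
def squareRTilde (k : ℤ) : Set (ℝ × ℝ) :=
  {z | (eig k < 0 ∧ z.1 < eig (k + 1) ∧ z.2 < eig (k + 1)) ∨
    (0 < eig k ∧ z.1 ∈ Set.Ioo 0 (eig (k + 1)) ∧ z.2 ∈ Set.Ioo 0 (eig (k + 1)))}

/-- The points of `R̃_k` above `𝒟_k`. The squares `R_k` exhaust `R̃_k` as `ε₃, ε₄ → 0`, and the
curves in them agree on common squares; so a point is above `𝒟_k` if it is in one of the
squares `R_k`, above the curve there. -/
def aboveD (k : ℤ) : Set (ℝ × ℝ) :=
  {z | z ∈ squareRTilde k ∧ ∃ ε₃ ε₄ : ℝ, Admissible k ε₃ ε₄ ∧ z ∈ aboveInSquare k ε₃ ε₄}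

/-! ## The hypotheses on `p` -/

/-- `p(s,t,u)/u → 0` as `|u| → ∞`, uniformly in `(s,t)`. -/
def SublinearAtInfinity (p : Strip → ℝ → ℝ) : Prop :=
  TendstoUniformly (fun (u : ℝ) (z : Strip) => p z u / u) (fun _ => 0) (cocompact ℝ)

/-- The function `u ↦ a u⁺ - b u⁻ + p(s,t,u)`, `z = (s,t)`. -/
def nonlinearity (a b : ℝ) (p : Strip → ℝ → ℝ) (z : Strip) (u : ℝ) : ℝ :=
  a * max u 0 - b * max (-u) 0 + p z u

/-- (H1′) `u ↦ a u⁺ - b u⁻ + p(s,t,u) - (λ_{k+1} - ε) u` is decreasing. -/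
def HypH1' (k : ℤ) (a b : ℝ) (p : Strip → ℝ → ℝ) : Prop :=
  ∃ ε : ℝ, 0 < ε ∧ ∀ z, Antitone (fun u => nonlinearity a b p z u - (eig (k + 1) - ε) * u)

/-- (H2′) If `λ_k > 0`, then `u ↦ a u⁺ - b u⁻ + p(s,t,u) - ε u` is increasing. -/
def HypH2' (k : ℤ) (a b : ℝ) (p : Strip → ℝ → ℝ) : Prop :=
  0 < eig k → ∃ ε : ℝ, 0 < ε ∧ ∀ z, Monotone (fun u => nonlinearity a b p z u - ε * u)

/-- (H3′) If `λ_k < 0`, then `u ↦ p(s,t,u) + (1/ε) u` is increasing. -/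
def HypH3' (k : ℤ) (p : Strip → ℝ → ℝ) : Prop :=
  eig k < 0 → ∃ ε : ℝ, 0 < ε ∧ ∀ z, Monotone (fun u => p z u + (1 / ε) * u)

end

end WaveFucik

/-!
The equation `□u = f(z, u)` with `f(z, u) = a u⁺ - b u⁻ + p(z, u)` is solved by a dual variational
method. Fix a shift `c` in the gap `(λ_k, λ_{k+1})` and put `v = (c - □) u`. With
`h(z, x) = c x - f(z, x)` and `M = (c - □)⁻¹`, the equation becomes `h(·, M v) = v`, which is the
critical point equation of `v ↦ K* v - ½ ⟪M v, v⟫`, where `K*` is the convex conjugate of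
`K u = ∫ (∫₀ᵘ h(z, τ) dτ) dz`.

When `c` is close to `λ_{k+1}`, (H1′), (H2′) and (H3′) bound the slope of `h` between a positive
number and some `L` with `1 / L > max 0 (1 / c)`. Hence `∇²K* ≥ 1 / L`, while all but finitely many
eigenvalues of `M` are below any given number exceeding `max 0 (1 / c)`: the dual functional is
strongly convex up to a finite-dimensional correction, so it attains its minimum once it is
coercive.

As `p` is sublinear, `K*` is bounded below, up to a small quadratic error, by the conjugate of the
positively homogeneous part of `K`, and coercivity reduces to positive definiteness of
`½ (‖v⁺‖² / (c - a) + ‖v⁻‖² / (c - b)) - ½ ⟪M v, v⟫`. For `c = λ_{k+1} - ε₃` this form is degenerate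
and nonnegative only on `𝒟_k`. Being definite and taking a negative value are open conditions
on `(a, b)`, and the form is definite for `(a, b) ∈ ]λ_k, c[²`, so by connectedness it is definite
above `𝒟_k`. It stays definite when `c` moves up to `λ_{k+1}`: definiteness could only be lost
through a nonzero solution of `□u = a u⁺ - b u⁻`, an equation that does not involve `c`.
-/

namespace WaveFucik

open MeasureTheory Real Filter Topology
open scoped ContDiff ENNReal

section Minimization

variable {H F : Type*} [NormedAddCommGroup H] [InnerProductSpace ℝ H]
  [NormedAddCommGroup F] [NormedSpace ℝ F]

lemma hasFDerivAt_of_abs_remainder_le {K : H → ℝ} {x n : H} {C : ℝ}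
    (h : ∀ d, |K (x + d) - K x - inner ℝ n d| ≤ C * ‖d‖ ^ 2) :
    HasFDerivAt K (innerSL ℝ n) x := by
  rw [hasFDerivAt_iff_isLittleO_nhds_zero]
  have remainder : (fun d : H => K (x + d) - K x - innerSL ℝ n d) =O[𝓝 0] fun d => ‖d‖ ^ 2 :=
    .of_bound C (.of_forall fun d => by simpa using h d)
  refine remainder.trans_isLittleO ?_
  simpa using Asymptotics.isLittleO_norm_pow_id (E' := H) one_lt_two

lemma eq_zero_of_forall_inner_add_nonneg {n : H} {C : ℝ}
    (h : ∀ d, 0 ≤ inner ℝ n d + C * ‖d‖ ^ 2) : n = 0 := by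
  have hderiv : HasFDerivAt (fun d => inner ℝ n d + C * ‖d‖ ^ 2) (innerSL ℝ n) 0 :=
    hasFDerivAt_of_abs_remainder_le (C := |C|) fun d => by simp [abs_mul]
  have hmin : IsLocalMin (fun d => inner ℝ n d + C * ‖d‖ ^ 2) 0 :=
    .of_forall fun d => by simpa using h d
  have hzero := DFunLike.congr_fun (hmin.hasFDerivAt_eq_zero hderiv) n
  simpa using hzero

/-- Strong convexity of `D` with modulus `κ` up to the quadratic form `C ‖T d‖²`, where `n` plays
the role of the gradient of `D`. -/
def StronglyConvexModulo (T : H →L[ℝ] F) (D : H → ℝ) (n : H → H) (κ C : ℝ) : Prop :=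
  ∀ x d, D x + inner ℝ (n x) d + κ * ‖d‖ ^ 2 - C * ‖T d‖ ^ 2 ≤ D (x + d)

namespace StronglyConvexModulo

variable {T : H →L[ℝ] F} {D : H → ℝ} {n : H → H} {κ C m : ℝ}

/-- The parallelogram argument: evaluate the convexity inequality at the midpoint of `x` and `y`,
where `D` is at least `m`. -/
lemma mul_norm_sub_sq_le (h : StronglyConvexModulo T D n κ C) (hm : ∀ x, m ≤ D x) (x y : H) :
    κ * ‖x - y‖ ^ 2 ≤ 2 * (D x - m) + 2 * (D y - m) + C * ‖T x - T y‖ ^ 2 := by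
  set z : H := (1 / 2 : ℝ) • (x + y) with hz
  set d : H := (1 / 2 : ℝ) • (x - y) with hd
  have hx : z + d = x := by rw [hz, hd]; module
  have hy : z + -d = y := by rw [hz, hd]; module
  have norm_d : ‖d‖ ^ 2 = ‖x - y‖ ^ 2 / 4 := by
    rw [hd, norm_smul, mul_pow]; norm_num; ring
  have norm_Td : ‖T d‖ ^ 2 = ‖T x - T y‖ ^ 2 / 4 := by
    rw [hd, map_smul, map_sub, norm_smul, mul_pow]; norm_num; ring
  have toward_x := h z d
  have toward_y := h z (-d)
  rw [hx, norm_d, norm_Td] at toward_x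
  rw [hy, inner_neg_right, norm_neg, map_neg, norm_neg, norm_d, norm_Td] at toward_y
  linarith [hm z]

lemma cauchySeq_of_tendsto (h : StronglyConvexModulo T D n κ C) (hκ : 0 < κ)
    (hm : ∀ x, m ≤ D x) {v : ℕ → H} (hD : Tendsto (fun j => D (v j)) atTop (𝓝 m))
    (hT : CauchySeq fun j => T (v j)) : CauchySeq v := by
  rw [cauchySeq_iff_tendsto_dist_atTop_0] at hT ⊢
  set bound : ℕ × ℕ → ℝ := fun i =>
    (2 * (D (v i.1) - m) + 2 * (D (v i.2) - m) + C * dist (T (v i.1)) (T (v i.2)) ^ 2) / κ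
  have hfst : Tendsto (fun i : ℕ × ℕ => D (v i.1)) atTop (𝓝 m) :=
    hD.comp (prod_atTop_atTop_eq (α := ℕ) (β := ℕ) ▸ tendsto_fst)
  have hsnd : Tendsto (fun i : ℕ × ℕ => D (v i.2)) atTop (𝓝 m) :=
    hD.comp (prod_atTop_atTop_eq (α := ℕ) (β := ℕ) ▸ tendsto_snd)
  have hbound : Tendsto bound atTop (𝓝 0) := by
    simpa using ((((hfst.sub_const m).const_mul 2).add ((hsnd.sub_const m).const_mul 2)).add
      ((hT.pow 2).const_mul C)).div_const κ
  have hsq : Tendsto (fun i : ℕ × ℕ => dist (v i.1) (v i.2) ^ 2) atTop (𝓝 0) :=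
    squeeze_zero (fun _ => sq_nonneg _) (fun i => by
      rw [le_div_iff₀' hκ, dist_eq_norm, dist_eq_norm]
      exact h.mul_norm_sub_sq_le hm _ _) hbound
  simpa using hsq.sqrt

lemma le_of_tendsto (h : StronglyConvexModulo T D n κ C) {v : ℕ → H} {w : H}
    (hv : Tendsto v atTop (𝓝 w)) (hD : Tendsto (fun j => D (v j)) atTop (𝓝 m)) : D w ≤ m := by
  have hcont : Continuous fun x =>
      D w + inner ℝ (n w) (x - w) + κ * ‖x - w‖ ^ 2 - C * ‖T (x - w)‖ ^ 2 := by fun_prop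
  refine le_of_tendsto_of_tendsto' (by simpa using (hcont.tendsto w).comp hv) hD fun j => ?_
  simpa using h w (v j - w)

lemma exists_subseq_tendsto [CompleteSpace H] [ProperSpace F]
    (h : StronglyConvexModulo T D n κ C) (hκ : 0 < κ) (hm : ∀ x, m ≤ D x) {v : ℕ → H} {R : ℝ}
    (hv : ∀ j, ‖v j‖ ≤ R) (hD : Tendsto (fun j => D (v j)) atTop (𝓝 m)) :
    ∃ w, ∃ θ : ℕ → ℕ, StrictMono θ ∧ Tendsto (v ∘ θ) atTop (𝓝 w) ∧ D w ≤ m := by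
  have hTv : ∀ j, T (v j) ∈ Metric.closedBall (0 : F) (‖T‖ * R) := fun j =>
    mem_closedBall_zero_iff.2 (T.le_opNorm_of_le (hv j))
  obtain ⟨_, -, θ, hθ, hTlim⟩ := tendsto_subseq_of_bounded Metric.isBounded_closedBall hTv
  have hDθ := hD.comp hθ.tendsto_atTop
  obtain ⟨w, hw⟩ := cauchySeq_tendsto_of_complete
    (h.cauchySeq_of_tendsto (v := v ∘ θ) hκ hm hDθ hTlim.cauchySeq)
  exact ⟨w, θ, hθ, hw, h.le_of_tendsto hw hDθ⟩

lemma gradient_eq_zero_of_forall_le {L : ℝ} {x : H} (hmin : ∀ y, D x ≤ D y)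
    (hup : ∀ x d, D (x + d) ≤ D x + inner ℝ (n x) d + L * ‖d‖ ^ 2) : n x = 0 :=
  eq_zero_of_forall_inner_add_nonneg (C := L) fun d => by linarith [hup x d, hmin (x + d)]

theorem exists_gradient_eq_zero [CompleteSpace H] [ProperSpace F] {L δ B : ℝ}
    (h : StronglyConvexModulo T D n κ C) (hκ : 0 < κ) (hδ : 0 < δ)
    (hup : ∀ x d, D (x + d) ≤ D x + inner ℝ (n x) d + L * ‖d‖ ^ 2)
    (hcoer : ∀ x, δ * ‖x‖ ^ 2 - B ≤ D x) : ∃ x, n x = 0 := by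
  have hbdd : BddBelow (Set.range D) := ⟨-B, by
    rintro _ ⟨x, rfl⟩
    have : 0 ≤ δ * ‖x‖ ^ 2 := by positivity
    linarith [hcoer x]⟩
  have hinf : ∀ x, sInf (Set.range D) ≤ D x := fun x => csInf_le hbdd ⟨x, rfl⟩
  obtain ⟨_, -, hlim, hmem⟩ := exists_seq_tendsto_sInf (Set.range_nonempty D) hbdd
  choose v hv using hmem
  obtain rfl := funext hv
  obtain ⟨Y, hY⟩ := hlim.bddAbove_range
  have hvb : ∀ j, ‖v j‖ ≤ √((Y + B) / δ) := fun j => by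
    refine Real.le_sqrt_of_sq_le ((le_div_iff₀' hδ).2 ?_)
    linarith [hcoer (v j), hY ⟨j, rfl⟩]
  obtain ⟨w, -, -, -, hmin⟩ := h.exists_subseq_tendsto hκ hinf hvb hlim
  exact ⟨w, gradient_eq_zero_of_forall_le (fun y => hmin.trans (hinf y)) hup⟩

theorem exists_ne_zero_gradient_eq_zero [CompleteSpace H] [ProperSpace F] {L : ℝ}
    (h : StronglyConvexModulo T D n κ C) (hκ : 0 < κ)
    (hup : ∀ x d, D (x + d) ≤ D x + inner ℝ (n x) d + L * ‖d‖ ^ 2)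
    (hhom : ∀ t : ℝ, 0 ≤ t → ∀ x, D (t • x) = t ^ 2 * D x) (hnonneg : ∀ x, 0 ≤ D x)
    (hdegenerate : ∀ δ > 0, ∃ x, D x < δ * ‖x‖ ^ 2) : ∃ x ≠ 0, n x = 0 := by
  have hunit : ∀ j : ℕ, ∃ x, ‖x‖ = 1 ∧ D x ≤ 1 / ((j : ℝ) + 1) := fun j => by
    obtain ⟨x, hx⟩ := hdegenerate _ (Nat.one_div_pos_of_nat (α := ℝ) (n := j))
    have hx0 : x ≠ 0 := by
      rintro rfl
      rw [norm_zero, zero_pow two_ne_zero, mul_zero] at hx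
      exact hx.not_ge (hnonneg 0)
    refine ⟨‖x‖⁻¹ • x, norm_smul_inv_norm (𝕜 := ℝ) hx0, ?_⟩
    rw [hhom _ (by positivity), inv_pow, ← div_eq_inv_mul, div_le_iff₀ (by positivity)]
    exact hx.le
  choose v hv hDv using hunit
  have hlim : Tendsto (fun j => D (v j)) atTop (𝓝 0) :=
    squeeze_zero (fun _ => hnonneg _) hDv tendsto_one_div_add_atTop_nhds_zero_nat
  obtain ⟨w, θ, -, hw, hmin⟩ := h.exists_subseq_tendsto hκ hnonneg (fun j => (hv j).le) hlim
  have hw1 : ‖w‖ = 1 :=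
    tendsto_nhds_unique hw.norm (tendsto_const_nhds.congr fun j => (hv (θ j)).symm)
  exact ⟨w, norm_ne_zero_iff.1 (hw1 ▸ one_ne_zero),
    gradient_eq_zero_of_forall_le (fun y => hmin.trans (hnonneg y)) hup⟩

end StronglyConvexModulo

/-- The functional `K` has gradient `N`, with first-order remainder between `σ/2 ‖d‖²` and
`L/2 ‖d‖²`; for `K` of class `C²` this says `σ ≤ ∇²K ≤ L`. -/
def HasQuadraticBounds (K : H → ℝ) (N : H → H) (σ L : ℝ) : Prop :=
  ∀ x d, σ / 2 * ‖d‖ ^ 2 ≤ K (x + d) - K x - inner ℝ (N x) d ∧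
    K (x + d) - K x - inner ℝ (N x) d ≤ L / 2 * ‖d‖ ^ 2

/-- The Legendre transform of `K`, where `R` is an inverse of the gradient of `K`. -/
def legendre (K : H → ℝ) (R : H → H) (v : H) : ℝ := inner ℝ (R v) v - K (R v)

lemma mul_le_weighted_sq_add_sq {s : ℝ} (hs : 0 < s) (x y : ℝ) :
    x * y ≤ s / 2 * x ^ 2 + 1 / s / 2 * y ^ 2 := by
  have : s / 2 * x ^ 2 + 1 / s / 2 * y ^ 2 - x * y = (s * x - y) ^ 2 / (2 * s) := by
    field_simp; ring
  have : 0 ≤ (s * x - y) ^ 2 / (2 * s) := by positivity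
  linarith

namespace HasQuadraticBounds

variable {K : H → ℝ} {N R : H → H} {σ L : ℝ}

lemma hasFDerivAt (h : HasQuadraticBounds K N σ L) (x : H) :
    HasFDerivAt K (innerSL ℝ (N x)) x :=
  hasFDerivAt_of_abs_remainder_le (C := max |σ / 2| |L / 2|) fun d => by
    rw [abs_le]
    constructor
    · have : -(max |σ / 2| |L / 2|) ≤ σ / 2 :=
        (neg_le_neg (le_max_left _ _)).trans (neg_abs_le _)
      nlinarith [(h x d).1, sq_nonneg ‖d‖]
    · have : L / 2 ≤ max |σ / 2| |L / 2| := (le_abs_self _).trans (le_max_right _ _)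
      nlinarith [(h x d).2, sq_nonneg ‖d‖]

theorem surjective_gradient [CompleteSpace H] (h : HasQuadraticBounds K N σ L) (hσ : 0 < σ) :
    Function.Surjective N := fun v => by
  have hconv : StronglyConvexModulo (0 : H →L[ℝ] ℝ) (fun u => K u - inner ℝ v u)
      (fun u => N u - v) (σ / 2) 0 := fun x d => by
    have := (h x d).1
    simp only [inner_add_right, inner_sub_left, zero_mul, sub_zero]
    linarith
  obtain ⟨u, hu⟩ := hconv.exists_gradient_eq_zero (half_pos hσ) (L := L / 2) (δ := σ / 4)
    (B := 1 / (σ / 2) / 2 * ‖N 0 - v‖ ^ 2 - K 0) (by positivity)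
    (fun x d => by
      have := (h x d).2
      simp only [inner_add_right, inner_sub_left]
      linarith)
    (fun x => by
      have hquad := (h 0 x).1
      have hinner : -(‖x‖ * ‖N 0 - v‖) ≤ inner ℝ (N 0 - v) x :=
        mul_comm ‖x‖ _ ▸ (abs_le.1 (abs_real_inner_le_norm _ _)).1
      rw [zero_add] at hquad
      rw [inner_sub_left] at hinner
      linarith [mul_le_weighted_sq_add_sq (half_pos hσ) ‖x‖ ‖N 0 - v‖])
  exact ⟨u, sub_eq_zero.1 hu⟩

lemma inner_sub_le_legendre (h : HasQuadraticBounds K N σ L) (hσ : 0 ≤ σ)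
    (hR : Function.RightInverse R N) (u v : H) : inner ℝ u v - K u ≤ legendre K R v := by
  have hquad := (h (R v) (u - R v)).1
  rw [hR, add_sub_cancel, inner_sub_right, real_inner_comm u v, real_inner_comm (R v) v] at hquad
  have : 0 ≤ σ / 2 * ‖u - R v‖ ^ 2 := by positivity
  rw [legendre]
  linarith

/-- The lower bound is Fenchel's inequality at `R v + d / L`. -/
lemma legendre (h : HasQuadraticBounds K N σ L) (hσ : 0 < σ) (hL : 0 < L)
    (hR : Function.RightInverse R N) :
    HasQuadraticBounds (legendre K R) R (1 / L) (1 / σ) := fun v d => by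
  constructor
  · have hfenchel := h.inner_sub_le_legendre hσ.le hR (R v + (1 / L : ℝ) • d) (v + d)
    have hquad := (h (R v) ((1 / L : ℝ) • d)).2
    rw [hR, norm_smul, mul_pow, Real.norm_eq_abs, sq_abs, inner_smul_right,
      real_inner_comm d v, show L / 2 * ((1 / L) ^ 2 * ‖d‖ ^ 2) = 1 / L / 2 * ‖d‖ ^ 2 by
        field_simp] at hquad
    simp only [inner_add_left, inner_add_right, real_inner_smul_left,
      real_inner_self_eq_norm_sq] at hfenchel
    rw [WaveFucik.legendre, inner_add_right] at hfenchel
    rw [WaveFucik.legendre, WaveFucik.legendre, inner_add_right]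
    linarith
  · obtain ⟨e, he⟩ : ∃ e, R (v + d) = R v + e := ⟨_, (add_sub_cancel _ _).symm⟩
    have hquad := (h (R v) e).1
    rw [hR, real_inner_comm] at hquad
    simp only [WaveFucik.legendre, he, inner_add_left, inner_add_right]
    linarith [real_inner_le_norm e d, mul_le_weighted_sq_add_sq hσ ‖e‖ ‖d‖]

end HasQuadraticBounds

end Minimization

section Diagonal

variable {H : Type*} [NormedAddCommGroup H] [InnerProductSpace ℝ H] {ι : Type*}

/-- The operator with eigenvalue `κ i` on the member `e i` of an orthonormal system, and `0` on
the orthogonal complement. -/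
noncomputable def diagOp (e : ι → H) (κ : ι → ℝ) (v : H) : H :=
  ∑' i, (κ i * inner ℝ (e i) v) • e i

lemma diagOp_smul (e : ι → H) (κ : ι → ℝ) (t : ℝ) (v : H) :
    diagOp e κ (t • v) = t • diagOp e κ v := by
  rw [diagOp, diagOp, ← tsum_const_smul'']
  simp only [inner_smul_right, smul_smul, mul_left_comm]

/-- The coordinates with respect to finitely many members of an orthonormal system. -/
noncomputable def coordMap (e : ι → H) (J : Finset ι) : H →L[ℝ] (J → ℝ) :=
  ContinuousLinearMap.pi fun i => innerSL ℝ (e i)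

lemma sum_inner_sq_le_coordMap (e : ι → H) (J : Finset ι) (v : H) :
    ∑ i ∈ J, inner ℝ (e i) v ^ 2 ≤ J.card * ‖coordMap e J v‖ ^ 2 := by
  rw [← nsmul_eq_mul]
  refine Finset.sum_le_card_nsmul _ _ _ fun i hi => ?_
  rw [← sq_abs]
  exact pow_le_pow_left₀ (abs_nonneg _) (norm_le_pi_norm (coordMap e J v) ⟨i, hi⟩) 2

variable {e : ι → H} {κ κ' : ι → ℝ} {B B' : ℝ}

lemma summable_inner_sq (he : Orthonormal ℝ e) (v : H) :
    Summable fun i => inner ℝ (e i) v ^ 2 := by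
  simpa using he.inner_products_summable v

lemma tsum_inner_sq_le (he : Orthonormal ℝ e) (v : H) :
    ∑' i, inner ℝ (e i) v ^ 2 ≤ ‖v‖ ^ 2 := by
  simpa using he.tsum_inner_products_le v

lemma summable_mul_inner_sq (he : Orthonormal ℝ e) (hκ : ∀ i, |κ i| ≤ B) (v : H) :
    Summable fun i => (κ i * inner ℝ (e i) v) ^ 2 :=
  .of_nonneg_of_le (fun i => sq_nonneg _) (fun i => by
    rw [mul_pow, ← sq_abs (κ i)]
    gcongr
    exact hκ i) ((summable_inner_sq he v).mul_left (B ^ 2))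

variable [CompleteSpace H]

lemma summable_smul_of_summable_sq (he : Orthonormal ℝ e) {a : ι → ℝ}
    (ha : Summable fun i => a i ^ 2) : Summable fun i => a i • e i := by
  simpa using (he.orthogonalFamily.summable_iff_norm_sq_summable (f := a)).2 (by simpa using ha)

lemma hasSum_diagOp (he : Orthonormal ℝ e) (hκ : ∀ i, |κ i| ≤ B) (v : H) :
    HasSum (fun i => (κ i * inner ℝ (e i) v) • e i) (diagOp e κ v) :=
  (summable_smul_of_summable_sq he (summable_mul_inner_sq he hκ v)).hasSum

lemma hasSum_inner_diagOp (he : Orthonormal ℝ e) (hκ : ∀ i, |κ i| ≤ B) (v w : H) :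
    HasSum (fun i => κ i * inner ℝ (e i) v * inner ℝ (e i) w) (inner ℝ (diagOp e κ v) w) := by
  rw [real_inner_comm]
  refine ((innerSL ℝ w).hasSum (hasSum_diagOp he hκ v)).congr_fun fun i => ?_
  rw [innerSL_apply_apply, inner_smul_right, real_inner_comm w]

lemma inner_diagOp (he : Orthonormal ℝ e) (hκ : ∀ i, |κ i| ≤ B) (v : H) (j : ι) :
    inner ℝ (e j) (diagOp e κ v) = κ j * inner ℝ (e j) v := by
  classical
  have hsingle : HasSum (fun i => κ i * inner ℝ (e i) v * inner ℝ (e i) (e j))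
      (κ j * inner ℝ (e j) v * inner ℝ (e j) (e j)) :=
    hasSum_single j fun i hi => by rw [orthonormal_iff_ite.1 he i j, if_neg hi, mul_zero]
  rw [real_inner_comm, (hasSum_inner_diagOp he hκ v (e j)).unique hsingle,
    orthonormal_iff_ite.1 he j j, if_pos rfl, mul_one]

lemma inner_diagOp_comm (he : Orthonormal ℝ e) (hκ : ∀ i, |κ i| ≤ B) (v w : H) :
    inner ℝ (diagOp e κ v) w = inner ℝ (diagOp e κ w) v :=
  (hasSum_inner_diagOp he hκ v w).unique <|
    (hasSum_inner_diagOp he hκ w v).congr_fun fun i => by ring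

lemma diagOp_add (he : Orthonormal ℝ e) (hκ : ∀ i, |κ i| ≤ B) (v w : H) :
    diagOp e κ (v + w) = diagOp e κ v + diagOp e κ w :=
  (hasSum_diagOp he hκ (v + w)).unique <|
    ((hasSum_diagOp he hκ v).add (hasSum_diagOp he hκ w)).congr_fun fun i => by
      rw [inner_add_right, mul_add, add_smul]

lemma inner_diagOp_add_self (he : Orthonormal ℝ e) (hκ : ∀ i, |κ i| ≤ B) (v d : H) :
    inner ℝ (diagOp e κ (v + d)) (v + d) = inner ℝ (diagOp e κ v) v
      + 2 * inner ℝ (diagOp e κ v) d + inner ℝ (diagOp e κ d) d := by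
  rw [diagOp_add he hκ, inner_add_left, inner_add_right, inner_add_right,
    inner_diagOp_comm he hκ d v]
  ring

lemma inner_diagOp_self_le (he : Orthonormal ℝ e) (hκ : ∀ i, |κ i| ≤ B) {ρ : ℝ} (hρ : 0 ≤ ρ)
    {J : Finset ι} (hJ : ∀ i ∉ J, κ i ≤ ρ) (v : H) :
    inner ℝ (diagOp e κ v) v ≤ ρ * ‖v‖ ^ 2 + B * ∑ i ∈ J, inner ℝ (e i) v ^ 2 := by
  classical
  have hmain : HasSum (fun i => ρ * inner ℝ (e i) v ^ 2) (ρ * ∑' i, inner ℝ (e i) v ^ 2) :=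
    (summable_inner_sq he v).hasSum.mul_left ρ
  have hfinite : HasSum (fun i => if i ∈ J then B * inner ℝ (e i) v ^ 2 else 0)
      (B * ∑ i ∈ J, inner ℝ (e i) v ^ 2) := by
    rw [Finset.mul_sum, ← Finset.sum_congr rfl fun i (hi : i ∈ J) =>
      if_pos (c := i ∈ J) (t := B * inner ℝ (e i) v ^ 2) (e := 0) hi]
    exact hasSum_sum_of_ne_finset_zero fun i hi => if_neg hi
  have hle := hasSum_le (fun i => ?_) (hasSum_inner_diagOp he hκ v v) (hmain.add hfinite)
  · linarith [mul_le_mul_of_nonneg_left (tsum_inner_sq_le he v) hρ]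
  · have hsq := sq_nonneg (inner ℝ (e i) v)
    rw [mul_assoc, ← sq]
    split_ifs with hi
    · nlinarith [(le_abs_self _).trans (hκ i), mul_nonneg hρ hsq]
    · nlinarith [hJ i hi]

lemma abs_inner_diagOp_self_le (he : Orthonormal ℝ e) (hκ : ∀ i, |κ i| ≤ B) (hB : 0 ≤ B)
    (v : H) : |inner ℝ (diagOp e κ v) v| ≤ B * ‖v‖ ^ 2 := by
  have hbound : HasSum (fun i => B * inner ℝ (e i) v ^ 2) (B * ∑' i, inner ℝ (e i) v ^ 2) :=
    (summable_inner_sq he v).hasSum.mul_left B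
  have hform := hasSum_inner_diagOp he hκ v v
  have habs : ∀ i, |κ i * inner ℝ (e i) v * inner ℝ (e i) v| ≤ B * inner ℝ (e i) v ^ 2 :=
    fun i => by
      rw [mul_assoc, ← sq, abs_mul, abs_sq]
      gcongr
      exact hκ i
  refine le_trans ?_ (mul_le_mul_of_nonneg_left (tsum_inner_sq_le he v) hB)
  exact abs_le.2 ⟨hasSum_le (fun i => (abs_le.1 (habs i)).1) hbound.neg hform,
    hasSum_le (fun i => (abs_le.1 (habs i)).2) hform hbound⟩

lemma abs_inner_diagOp_self_sub_le (he : Orthonormal ℝ e) (hκ : ∀ i, |κ i| ≤ B)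
    (hκ' : ∀ i, |κ' i| ≤ B') {ε : ℝ} (hε : 0 ≤ ε) (h : ∀ i, |κ i - κ' i| ≤ ε) (v : H) :
    |inner ℝ (diagOp e κ v) v - inner ℝ (diagOp e κ' v) v| ≤ ε * ‖v‖ ^ 2 := by
  have hsub : inner ℝ (diagOp e (fun i => κ i - κ' i) v) v =
      inner ℝ (diagOp e κ v) v - inner ℝ (diagOp e κ' v) v :=
    (hasSum_inner_diagOp he h v v).unique <|
      ((hasSum_inner_diagOp he hκ v v).sub (hasSum_inner_diagOp he hκ' v v)).congr_fun fun i => by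
        ring
  exact hsub ▸ abs_inner_diagOp_self_le he h hε v

/-- Only the eigenvalues above `ρ` can spoil convexity, and those span a finite-dimensional
space. -/
lemma HasQuadraticBounds.stronglyConvexModulo_sub_diagOp (he : Orthonormal ℝ e)
    (hκ : ∀ i, |κ i| ≤ B) (hB : 0 ≤ B) {ρ : ℝ} (hρ : 0 ≤ ρ) {J : Finset ι}
    (hJ : ∀ i ∉ J, κ i ≤ ρ) {K : H → ℝ} {N : H → H} {σ L : ℝ} (h : HasQuadraticBounds K N σ L) :
    StronglyConvexModulo (coordMap e J) (fun v => K v - inner ℝ (diagOp e κ v) v / 2)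
      (fun v => N v - diagOp e κ v) ((σ - ρ) / 2) (B * J.card / 2) := fun x d => by
  beta_reduce
  rw [inner_diagOp_add_self he hκ, inner_sub_left]
  linarith [(h x d).1, inner_diagOp_self_le he hκ hρ hJ d,
    mul_le_mul_of_nonneg_left (sum_inner_sq_le_coordMap e J d) hB]

lemma HasQuadraticBounds.sub_diagOp_le (he : Orthonormal ℝ e) (hκ : ∀ i, |κ i| ≤ B)
    (hB : 0 ≤ B) {K : H → ℝ} {N : H → H} {σ L : ℝ} (h : HasQuadraticBounds K N σ L) (x d : H) :
    K (x + d) - inner ℝ (diagOp e κ (x + d)) (x + d) / 2 ≤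
      (K x - inner ℝ (diagOp e κ x) x / 2) + inner ℝ (N x - diagOp e κ x) d
      + (L + B) / 2 * ‖d‖ ^ 2 := by
  rw [inner_diagOp_add_self he hκ, inner_sub_left]
  linarith [(h x d).2, (abs_le.1 (abs_inner_diagOp_self_le he hκ hB d)).1]

theorem HasQuadraticBounds.exists_gradient_diagOp_eq (he : Orthonormal ℝ e)
    (hκ : ∀ i, |κ i| ≤ B) (hB : 0 ≤ B) {ρ : ℝ} (hρ : 0 ≤ ρ) {J : Finset ι}
    (hJ : ∀ i ∉ J, κ i ≤ ρ) {K : H → ℝ} {N : H → H} {σ L δ C : ℝ}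
    (h : HasQuadraticBounds K N σ L) (hσ : 0 < σ) (hL : 0 < L) (hρL : ρ < 1 / L) (hδ : 0 < δ)
    (hcoer : ∀ v, ∃ u,
      δ * ‖v‖ ^ 2 - C ≤ inner ℝ u v - K u - inner ℝ (diagOp e κ v) v / 2) :
    ∃ v, N (diagOp e κ v) = v := by
  obtain ⟨R, hR⟩ := (h.surjective_gradient hσ).hasRightInverse
  have hdual := h.legendre hσ hL hR
  obtain ⟨v, hv⟩ := (hdual.stronglyConvexModulo_sub_diagOp he hκ hB hρ hJ).exists_gradient_eq_zero
    (B := C) (half_pos (sub_pos.2 hρL)) hδ (hdual.sub_diagOp_le he hκ hB) fun v => by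
      obtain ⟨u, hu⟩ := hcoer v
      linarith [h.inner_sub_le_legendre hσ.le hR u v]
  exact ⟨v, sub_eq_zero.1 hv ▸ hR v⟩

end Diagonal

section Primitive

lemma mul_sub_le_integral_of_monotone {f : ℝ → ℝ} (hf : Monotone f) (x y : ℝ) :
    f x * (y - x) ≤ ∫ τ in x..y, f τ := by
  rcases le_total x y with hxy | hyx
  · have := intervalIntegral.integral_mono_on (μ := volume) hxy intervalIntegrable_const
      hf.intervalIntegrable fun τ hτ => hf hτ.1
    rwa [intervalIntegral.integral_const, smul_eq_mul, mul_comm] at this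
  · have := intervalIntegral.integral_mono_on (μ := volume) hyx hf.intervalIntegrable
      intervalIntegrable_const fun τ hτ => hf hτ.2
    rw [intervalIntegral.integral_const, smul_eq_mul] at this
    rw [intervalIntegral.integral_symm]
    linarith

lemma sq_le_integral_sub_of_monotone {f : ℝ → ℝ} {σ : ℝ} (hf : Monotone fun x => f x - σ * x)
    (x d : ℝ) : σ / 2 * d ^ 2 ≤ (∫ τ in x..x + d, f τ) - f x * d := by
  have hlin : Continuous fun τ : ℝ => σ * τ := by fun_prop
  have hsplit : ∫ τ in x..x + d, f τ =
      (∫ τ in x..x + d, (f τ - σ * τ)) + ∫ τ in x..x + d, σ * τ := by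
    rw [← intervalIntegral.integral_add hf.intervalIntegrable (hlin.intervalIntegrable _ _)]
    simp only [sub_add_cancel]
  have hmono := mul_sub_le_integral_of_monotone hf x (x + d)
  rw [hsplit, intervalIntegral.integral_const_mul, integral_id]
  linarith

/-- The slope of `f` lies in `[σ, L]`. -/
def SlopeBounds (f : ℝ → ℝ) (σ L : ℝ) : Prop :=
  Monotone (fun x => f x - σ * x) ∧ Antitone fun x => f x - L * x

namespace SlopeBounds

variable {f : ℝ → ℝ} {σ L : ℝ}

lemma sub_mem_Icc (h : SlopeBounds f σ L) {x y : ℝ} (hxy : x ≤ y) :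
    f y - f x ∈ Set.Icc (σ * (y - x)) (L * (y - x)) := by
  have hσ := h.1 hxy
  have hL := h.2 hxy
  simp only at hσ hL
  constructor <;> linarith

lemma le (h : SlopeBounds f σ L) : σ ≤ L := by
  have := h.sub_mem_Icc zero_le_one
  linarith [this.1, this.2]

lemma abs_sub_le (h : SlopeBounds f σ L) (x y : ℝ) :
    |f y - f x| ≤ (|σ| + |L|) * |y - x| := by
  wlog hxy : x ≤ y generalizing x y
  · rw [abs_sub_comm, abs_sub_comm y]
    exact this y x (le_of_not_ge hxy)
  have hslope := h.sub_mem_Icc hxy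
  rw [abs_of_nonneg (sub_nonneg.2 hxy), abs_le]
  constructor <;> nlinarith [hslope.1, hslope.2, neg_abs_le σ, le_abs_self L, abs_nonneg σ,
    abs_nonneg L, sub_nonneg.2 hxy]

lemma intervalIntegrable (h : SlopeBounds f σ L) (x y : ℝ) :
    IntervalIntegrable f volume x y := by
  have hlin : Continuous fun τ : ℝ => σ * τ := by fun_prop
  simpa using h.1.intervalIntegrable.add (hlin.intervalIntegrable x y)

lemma integral_sub_mem_Icc (h : SlopeBounds f σ L) (x d : ℝ) :
    (∫ τ in x..x + d, f τ) - f x * d ∈ Set.Icc (σ / 2 * d ^ 2) (L / 2 * d ^ 2) := by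
  refine ⟨sq_le_integral_sub_of_monotone h.1 x d, ?_⟩
  have hneg : Monotone fun x => (-f) x - -L * x := fun x y hxy => by
    simpa [neg_add_eq_sub] using neg_le_neg (h.2 hxy)
  have := sq_le_integral_sub_of_monotone hneg x d
  simp only [Pi.neg_apply, intervalIntegral.integral_neg] at this
  linarith

end SlopeBounds

/-- The primitive `∫₀ˣ g(z,τ) dτ` of a function `g` with parameter `z`. -/
noncomputable def primitive {X : Type*} (g : X → ℝ → ℝ) (z : X) (x : ℝ) : ℝ :=
  ∫ τ in (0 : ℝ)..x, g z τ

variable {X : Type*} {g : X → ℝ → ℝ}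

lemma abs_primitive_le_of_abs_le {z : X} {s C : ℝ} (hs : 0 ≤ s)
    (h : ∀ x, |g z x| ≤ s * |x| + C) (x : ℝ) : |primitive g z x| ≤ s * x ^ 2 + C * |x| := by
  have hbound := intervalIntegral.norm_integral_le_of_norm_le_const (a := 0) (b := x)
    (f := g z) (C := s * |x| + C) fun τ hτ => by
      refine (h τ).trans ?_
      have := Set.abs_sub_left_of_mem_uIcc (Set.uIoc_subset_uIcc hτ)
      rw [sub_zero, sub_zero] at this
      gcongr
  refine hbound.trans_eq ?_
  rw [sub_zero, ← sq_abs x]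
  ring

lemma SlopeBounds.primitive_sub {z : X} {σ L : ℝ} (h : SlopeBounds (g z) σ L) (x d : ℝ) :
    primitive g z (x + d) - primitive g z x = ∫ τ in x..x + d, g z τ :=
  intervalIntegral.integral_interval_sub_left (h.intervalIntegrable _ _) (h.intervalIntegrable _ _)

variable [TopologicalSpace X]

lemma continuous_primitive (hg : Continuous (Function.uncurry g)) :
    Continuous (Function.uncurry (primitive g)) :=
  intervalIntegral.continuous_parametric_intervalIntegral_of_continuous
    (f := fun (q : X × ℝ) τ => g q.1 τ) (s := fun q : X × ℝ => q.2) (a₀ := 0)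
    (by fun_prop) continuous_snd

variable [CompactSpace X]

lemma exists_abs_le_of_abs_le (hg : Continuous (Function.uncurry g)) (R : ℝ) :
    ∃ C, 0 ≤ C ∧ ∀ z x, |x| ≤ R → |g z x| ≤ C := by
  obtain ⟨C, hC⟩ := (isCompact_univ.prod
    (isCompact_Icc (a := -R) (b := R))).exists_bound_of_continuousOn hg.continuousOn
  exact ⟨|C|, abs_nonneg _, fun z x hx =>
    (hC (z, x) ⟨trivial, abs_le.1 hx⟩).trans (le_abs_self C)⟩

lemma exists_abs_le_of_slopeBounds (hg : Continuous (Function.uncurry g)) {σ L : ℝ}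
    (h : ∀ z, SlopeBounds (g z) σ L) :
    ∃ C, 0 ≤ C ∧ ∀ z x, |g z x| ≤ (|σ| + |L|) * |x| + C := by
  obtain ⟨C, hC₀, hC⟩ := exists_abs_le_of_abs_le hg 0
  refine ⟨C, hC₀, fun z x => ?_⟩
  have hdiff := (h z).abs_sub_le 0 x
  rw [sub_zero] at hdiff
  linarith [abs_sub_abs_le_abs_sub (g z x) (g z 0), hC z 0 (by simp)]

end Primitive

section Superposition

variable {X : Type*} [MeasurableSpace X] {μ : Measure X} {g : X → ℝ → ℝ} {σ L : ℝ}

lemma inner_eq_integral (u v : Lp ℝ 2 μ) : inner ℝ u v = ∫ z, u z * v z ∂μ := by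
  simp only [L2.inner_def, Real.inner_apply]

lemma norm_sq_eq_integral (u : Lp ℝ 2 μ) : ‖u‖ ^ 2 = ∫ z, u z ^ 2 ∂μ := by
  rw [← real_inner_self_eq_norm_sq, inner_eq_integral]
  simp only [sq]

lemma hasQuadraticBounds_integral_primitive {N : Lp ℝ 2 μ → Lp ℝ 2 μ}
    (hN : ∀ u, N u =ᵐ[μ] fun z => g z (u z))
    (hint : ∀ u : Lp ℝ 2 μ, Integrable (fun z => primitive g z (u z)) μ)
    (h : ∀ z, SlopeBounds (g z) σ L) :
    HasQuadraticBounds (fun u : Lp ℝ 2 μ => ∫ z, primitive g z (u z) ∂μ) N σ L := fun u d => by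
  have hlinear : Integrable (fun z => N u z * d z) μ := (Lp.memLp _).integrable_mul (Lp.memLp d)
  have hsq : Integrable (fun z => d z ^ 2) μ := (Lp.memLp d).integrable_sq
  have hdiff : Integrable
      (fun z => primitive g z ((u + d : Lp ℝ 2 μ) z) - primitive g z (u z)) μ :=
    (hint (u + d)).sub (hint u)
  have hpointwise : ∀ᵐ z ∂μ, primitive g z ((u + d : Lp ℝ 2 μ) z) - primitive g z (u z)
      - N u z * d z ∈ Set.Icc (σ / 2 * d z ^ 2) (L / 2 * d z ^ 2) := by
    filter_upwards [Lp.coeFn_add u d, hN u] with z hadd hNz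
    rw [hadd, hNz, Pi.add_apply, (h z).primitive_sub]
    exact (h z).integral_sub_mem_Icc _ _
  beta_reduce
  rw [inner_eq_integral, ← integral_sub (hint _) (hint _), ← integral_sub hdiff hlinear,
    norm_sq_eq_integral, ← integral_const_mul, ← integral_const_mul]
  exact ⟨integral_mono_ae (hsq.const_mul _) (hdiff.sub hlinear) (hpointwise.mono fun z hz => hz.1),
    integral_mono_ae (hdiff.sub hlinear) (hsq.const_mul _) (hpointwise.mono fun z hz => hz.2)⟩

variable [TopologicalSpace X] [CompactSpace X] [TopologicalSpace.PseudoMetrizableSpace X]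
  [SecondCountableTopology X] [OpensMeasurableSpace X] [IsFiniteMeasure μ]

lemma memLp_comp (hg : Continuous (Function.uncurry g)) (h : ∀ z, SlopeBounds (g z) σ L)
    (u : Lp ℝ 2 μ) : MemLp (fun z => g z (u z)) 2 μ := by
  obtain ⟨C, -, hC⟩ := exists_abs_le_of_slopeBounds hg h
  have hdom : MemLp (fun z => (|σ| + |L|) * ‖u z‖ + C) 2 μ :=
    ((Lp.memLp u).norm.const_mul _).add (memLp_const C)
  refine hdom.mono' (hg.comp_aestronglyMeasurable
    (aestronglyMeasurable_id.prodMk (Lp.aestronglyMeasurable u))) (.of_forall fun z => ?_)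
  simpa using hC z (u z)

lemma integrable_primitive (hg : Continuous (Function.uncurry g))
    (h : ∀ z, SlopeBounds (g z) σ L) (u : Lp ℝ 2 μ) :
    Integrable (fun z => primitive g z (u z)) μ := by
  obtain ⟨C, -, hC⟩ := exists_abs_le_of_slopeBounds hg h
  have hdom : Integrable (fun z => (|σ| + |L|) * u z ^ 2 + C * ‖u z‖) μ :=
    ((Lp.memLp u).integrable_sq.const_mul _).add
      (((Lp.memLp u).integrable (by norm_num)).norm.const_mul C)
  refine hdom.mono' ((continuous_primitive hg).comp_aestronglyMeasurable
    (aestronglyMeasurable_id.prodMk (Lp.aestronglyMeasurable u))) (.of_forall fun z => ?_)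
  simpa using abs_primitive_le_of_abs_le (by positivity) (hC z) (u z)

/-- The superposition operator `u ↦ g(·, u(·))` on `L²`. -/
noncomputable def superpose (hg : Continuous (Function.uncurry g))
    (h : ∀ z, SlopeBounds (g z) σ L) (u : Lp ℝ 2 μ) : Lp ℝ 2 μ :=
  (memLp_comp hg h u).toLp _

lemma coeFn_superpose (hg : Continuous (Function.uncurry g)) (h : ∀ z, SlopeBounds (g z) σ L)
    (u : Lp ℝ 2 μ) : superpose hg h u =ᵐ[μ] fun z => g z (u z) :=
  (memLp_comp hg h u).coeFn_toLp

lemma hasQuadraticBounds_superpose (hg : Continuous (Function.uncurry g))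
    (h : ∀ z, SlopeBounds (g z) σ L) :
    HasQuadraticBounds (fun u : Lp ℝ 2 μ => ∫ z, primitive g z (u z) ∂μ) (superpose hg h) σ L :=
  hasQuadraticBounds_integral_primitive (coeFn_superpose hg h) (integrable_primitive hg h) h

end Superposition

section Jump

/-- The piecewise linear function `x ↦ α x⁺ - β x⁻`. -/
def jump (α β x : ℝ) : ℝ := α * max x 0 - β * max (-x) 0

lemma jump_of_nonneg (α β : ℝ) {x : ℝ} (hx : 0 ≤ x) : jump α β x = α * x := by
  rw [jump, max_eq_left hx, max_eq_right (neg_nonpos.2 hx), mul_zero, sub_zero]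

lemma jump_of_nonpos (α β : ℝ) {x : ℝ} (hx : x ≤ 0) : jump α β x = β * x := by
  rw [jump, max_eq_right hx, max_eq_left (neg_nonneg.2 hx)]
  ring

lemma jump_jump {α β : ℝ} (hα : 0 ≤ α) (hβ : 0 ≤ β) (α' β' x : ℝ) :
    jump α' β' (jump α β x) = jump (α' * α) (β' * β) x := by
  rcases le_total 0 x with hx | hx
  · rw [jump_of_nonneg α β hx, jump_of_nonneg _ _ hx, jump_of_nonneg _ _ (by positivity), mul_assoc]
  · rw [jump_of_nonpos α β hx, jump_of_nonpos _ _ hx,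
      jump_of_nonpos _ _ (mul_nonpos_of_nonneg_of_nonpos hβ hx), mul_assoc]

lemma jump_add_mul (α β c x : ℝ) : jump α β x + c * x = jump (α + c) (β + c) x := by
  rw [jump, jump]
  linear_combination -c * max_zero_sub_max_neg_zero_eq_self x

lemma jump_sub_sub (α β c x : ℝ) : jump (c - α) (c - β) x = c * x - jump α β x := by
  rw [jump, jump]
  linear_combination c * max_zero_sub_max_neg_zero_eq_self x

lemma slopeBounds_jump (α β : ℝ) : SlopeBounds (jump α β) (min α β) (max α β) := by
  have hα := min_le_left α β
  have hβ := min_le_right α β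
  have hα' := le_max_left α β
  have hβ' := le_max_right α β
  constructor <;> intro x y hxy <;>
    rcases le_total 0 x with hx | hx <;> rcases le_total 0 y with hy | hy <;>
    simp only [jump_of_nonneg, jump_of_nonpos, hx, hy] <;> nlinarith

lemma primitive_jump {X : Type*} (α β : ℝ) (z : X) (x : ℝ) :
    primitive (fun _ => jump α β) z x = α / 2 * (max x 0) ^ 2 + β / 2 * (max (-x) 0) ^ 2 := by
  have hlin (c : ℝ) : ∫ τ in (0 : ℝ)..x, c * τ = c / 2 * x ^ 2 := by
    rw [intervalIntegral.integral_const_mul, integral_id]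
    ring
  rcases le_total 0 x with hx | hx
  · rw [max_eq_left hx, max_eq_right (neg_nonpos.2 hx), primitive,
      intervalIntegral.integral_congr (g := fun τ => α * τ) (fun τ hτ => ?_), hlin]
    · ring
    · rw [Set.uIcc_of_le hx] at hτ
      exact jump_of_nonneg _ _ hτ.1
  · rw [max_eq_right hx, max_eq_left (neg_nonneg.2 hx), primitive,
      intervalIntegral.integral_congr (g := fun τ => β * τ) (fun τ hτ => ?_), hlin]
    · ring
    · rw [Set.uIcc_of_ge hx] at hτ
      exact jump_of_nonpos _ _ hτ.2

variable {X : Type*} [MeasurableSpace X] {μ : Measure X}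

/-- The superposition operator `u ↦ α u⁺ - β u⁻` on `L²`. -/
noncomputable def jumpOp (α β : ℝ) (u : Lp ℝ 2 μ) : Lp ℝ 2 μ :=
  α • Lp.posPart u - β • Lp.negPart u

/-- The functional `½ (α ‖u⁺‖² + β ‖u⁻‖²)`, with gradient `jumpOp α β`. -/
noncomputable def jumpEnergy (α β : ℝ) (u : Lp ℝ 2 μ) : ℝ :=
  α / 2 * ‖Lp.posPart u‖ ^ 2 + β / 2 * ‖Lp.negPart u‖ ^ 2

lemma coeFn_jumpOp (α β : ℝ) (u : Lp ℝ 2 μ) : jumpOp α β u =ᵐ[μ] fun z => jump α β (u z) := by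
  filter_upwards [Lp.coeFn_sub (α • Lp.posPart u) (β • Lp.negPart u),
    Lp.coeFn_smul α (Lp.posPart u), Lp.coeFn_smul β (Lp.negPart u), Lp.coeFn_posPart u,
    Lp.coeFn_negPart_eq_max u] with z hsub hα hβ hpos hneg
  rw [jumpOp, hsub, Pi.sub_apply, hα, hβ, Pi.smul_apply, Pi.smul_apply, hpos, hneg, smul_eq_mul,
    smul_eq_mul, jump]

lemma norm_posPart_sq (u : Lp ℝ 2 μ) : ‖Lp.posPart u‖ ^ 2 = ∫ z, (max (u z) 0) ^ 2 ∂μ := by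
  rw [norm_sq_eq_integral]
  exact integral_congr_ae ((Lp.coeFn_posPart u).mono fun z hz => by simp only [hz])

lemma norm_negPart_sq (u : Lp ℝ 2 μ) : ‖Lp.negPart u‖ ^ 2 = ∫ z, (max (-u z) 0) ^ 2 ∂μ := by
  rw [norm_sq_eq_integral]
  exact integral_congr_ae ((Lp.coeFn_negPart_eq_max u).mono fun z hz => by simp only [hz])

lemma integrable_posPart_sq (u : Lp ℝ 2 μ) : Integrable (fun z => (max (u z) 0) ^ 2) μ :=
  (Lp.memLp (Lp.posPart u)).integrable_sq.congr
    ((Lp.coeFn_posPart u).mono fun z hz => by simp only [hz])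

lemma integrable_negPart_sq (u : Lp ℝ 2 μ) : Integrable (fun z => (max (-u z) 0) ^ 2) μ :=
  (Lp.memLp (Lp.negPart u)).integrable_sq.congr
    ((Lp.coeFn_negPart_eq_max u).mono fun z hz => by simp only [hz])

lemma integrable_primitive_jump (α β : ℝ) (u : Lp ℝ 2 μ) :
    Integrable (fun z => primitive (fun _ => jump α β) z (u z)) μ := by
  simp only [primitive_jump]
  exact ((integrable_posPart_sq u).const_mul _).add ((integrable_negPart_sq u).const_mul _)

lemma integral_primitive_jump (α β : ℝ) (u : Lp ℝ 2 μ) :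
    ∫ z, primitive (fun _ => jump α β) z (u z) ∂μ = jumpEnergy α β u := by
  simp only [primitive_jump, jumpEnergy, norm_posPart_sq, norm_negPart_sq]
  rw [integral_add ((integrable_posPart_sq u).const_mul _) ((integrable_negPart_sq u).const_mul _),
    integral_const_mul, integral_const_mul]

lemma norm_posPart_sq_add_norm_negPart_sq (u : Lp ℝ 2 μ) :
    ‖Lp.posPart u‖ ^ 2 + ‖Lp.negPart u‖ ^ 2 = ‖u‖ ^ 2 := by
  rw [norm_posPart_sq, norm_negPart_sq, norm_sq_eq_integral,
    ← integral_add (integrable_posPart_sq u) (integrable_negPart_sq u)]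
  congr 1 with z
  rcases le_total 0 (u z) with hz | hz
  · rw [max_eq_left hz, max_eq_right (neg_nonpos.2 hz)]
    ring
  · rw [max_eq_right hz, max_eq_left (neg_nonneg.2 hz)]
    ring

lemma hasQuadraticBounds_jumpEnergy (α β : ℝ) :
    HasQuadraticBounds (jumpEnergy (μ := μ) α β) (jumpOp α β) (min α β) (max α β) := by
  simpa only [integral_primitive_jump] using hasQuadraticBounds_integral_primitive (μ := μ)
    (coeFn_jumpOp α β) (integrable_primitive_jump α β) fun _ => slopeBounds_jump α β

lemma inner_jumpOp_self (α β : ℝ) (u : Lp ℝ 2 μ) :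
    inner ℝ (jumpOp α β u) u = 2 * jumpEnergy α β u := by
  rw [inner_eq_integral, ← integral_primitive_jump, ← integral_const_mul]
  refine integral_congr_ae ((coeFn_jumpOp α β u).mono fun z hz => ?_)
  simp only [hz, primitive_jump]
  rcases le_total 0 (u z) with hz | hz
  · rw [jump_of_nonneg _ _ hz, max_eq_left hz, max_eq_right (neg_nonpos.2 hz)]
    ring
  · rw [jump_of_nonpos _ _ hz, max_eq_right hz, max_eq_left (neg_nonneg.2 hz)]
    ring

lemma jumpOp_jumpOp {α β : ℝ} (hα : 0 ≤ α) (hβ : 0 ≤ β) (α' β' : ℝ) (u : Lp ℝ 2 μ) :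
    jumpOp α' β' (jumpOp α β u) = jumpOp (α' * α) (β' * β) u := by
  ext
  filter_upwards [coeFn_jumpOp α β u, coeFn_jumpOp α' β' (jumpOp α β u),
    coeFn_jumpOp (α' * α) (β' * β) u] with z hinner houter hprod
  rw [houter, hprod, hinner, jump_jump hα hβ]

lemma jumpOp_add_smul (α β c : ℝ) (u : Lp ℝ 2 μ) :
    jumpOp α β u + c • u = jumpOp (α + c) (β + c) u := by
  ext
  filter_upwards [coeFn_jumpOp α β u, coeFn_jumpOp (α + c) (β + c) u, Lp.coeFn_smul c u,
    Lp.coeFn_add (jumpOp α β u) (c • u)] with z hjump hjump' hsmul hadd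
  rw [hadd, Pi.add_apply, hjump, hjump', hsmul, Pi.smul_apply, smul_eq_mul, jump_add_mul]

lemma jumpOp_zero (α β : ℝ) : jumpOp α β (0 : Lp ℝ 2 μ) = 0 := by
  ext
  filter_upwards [coeFn_jumpOp α β (0 : Lp ℝ 2 μ), Lp.coeFn_zero ℝ 2 μ] with z hz hzero
  rw [hz, hzero, Pi.zero_apply, jump_of_nonneg α β le_rfl, mul_zero]

lemma jumpOp_one_one (u : Lp ℝ 2 μ) : jumpOp 1 1 u = u := by
  ext
  filter_upwards [coeFn_jumpOp 1 1 u] with z hz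
  rw [hz]
  rcases le_total 0 (u z) with h | h
  · rw [jump_of_nonneg _ _ h, one_mul]
  · rw [jump_of_nonpos _ _ h, one_mul]

lemma jumpEnergy_smul (α β : ℝ) {t : ℝ} (ht : 0 ≤ t) (u : Lp ℝ 2 μ) :
    jumpEnergy α β (t • u) = t ^ 2 * jumpEnergy α β u := by
  rw [← integral_primitive_jump, ← integral_primitive_jump, ← integral_const_mul]
  refine integral_congr_ae ((Lp.coeFn_smul t u).mono fun z hz => ?_)
  have hmax (x : ℝ) : max (t * x) 0 = t * max x 0 := by rw [mul_max_of_nonneg _ _ ht, mul_zero]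
  simp only [hz, Pi.smul_apply, smul_eq_mul, primitive_jump, ← mul_neg, hmax]
  ring

lemma mul_norm_sq_le_jumpEnergy {α β m : ℝ} (hα : m ≤ α) (hβ : m ≤ β) (u : Lp ℝ 2 μ) :
    m / 2 * ‖u‖ ^ 2 ≤ jumpEnergy α β u := by
  rw [jumpEnergy, ← norm_posPart_sq_add_norm_negPart_sq]
  nlinarith [sq_nonneg ‖Lp.posPart u‖, sq_nonneg ‖Lp.negPart u‖]

lemma mul_norm_le_norm_jumpOp {α β m : ℝ} (hα : m ≤ α) (hβ : m ≤ β) (u : Lp ℝ 2 μ) :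
    m * ‖u‖ ≤ ‖jumpOp α β u‖ := by
  rcases (norm_nonneg u).eq_or_lt with hu | hu
  · rw [← hu, mul_zero]
    exact norm_nonneg _
  · refine le_of_mul_le_mul_right ?_ hu
    linarith [mul_norm_sq_le_jumpEnergy hα hβ u, inner_jumpOp_self α β u,
      real_inner_le_norm (jumpOp α β u) u]

lemma abs_jumpEnergy_sub_le {α β α' β' ε : ℝ} (hα : |α - α'| ≤ ε) (hβ : |β - β'| ≤ ε)
    (u : Lp ℝ 2 μ) : |jumpEnergy α β u - jumpEnergy α' β' u| ≤ ε / 2 * ‖u‖ ^ 2 := by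
  rw [jumpEnergy, jumpEnergy, ← norm_posPart_sq_add_norm_negPart_sq u]
  obtain ⟨hα₁, hα₂⟩ := abs_le.1 hα
  obtain ⟨hβ₁, hβ₂⟩ := abs_le.1 hβ
  rw [abs_le]
  constructor <;> nlinarith [sq_nonneg ‖Lp.posPart u‖, sq_nonneg ‖Lp.negPart u‖]

end Jump

section IntegrationByParts

variable {f g : ℝ × Circ → ℝ}

lemma IsSmooth.hasDerivAt_partialS (hf : IsSmooth f) (s : ℝ) (t : Circ) :
    HasDerivAt (fun σ => f (σ, t)) (partialS f (s, t)) s := by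
  induction t using QuotientAddGroup.induction_on with
  | H t =>
    have hdiff : Differentiable ℝ (fun σ : ℝ => f (σ, (t : Circ))) :=
      (ContDiff.differentiable hf (by simp)).comp
        (g := fun q : ℝ × ℝ => f (q.1, (q.2 : Circ))) (f := fun σ : ℝ => (σ, t)) (by fun_prop)
    exact (hdiff s).hasDerivAt

lemma IsSmooth.hasDerivAt_partialT (hf : IsSmooth f) (s t : ℝ) :
    HasDerivAt (fun τ : ℝ => f (s, (τ : Circ))) (partialT f (s, (t : Circ))) t := by
  have hdiff : Differentiable ℝ (fun τ : ℝ => f (s, (τ : Circ))) :=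
    (ContDiff.differentiable hf (by simp)).comp
      (g := fun q : ℝ × ℝ => f (q.1, (q.2 : Circ))) (f := fun τ : ℝ => (s, τ)) (by fun_prop)
  have hshift := deriv_comp_const_add (f := fun τ : ℝ => f (s, (τ : Circ))) t 0
  rw [add_zero] at hshift
  exact (hdiff t).hasDerivAt.congr_deriv hshift.symm

lemma IsSmooth.mul (hf : IsSmooth f) (hg : IsSmooth g) : IsSmooth (fun q => f q * g q) :=
  ContDiff.mul hf hg

lemma IsSmooth.partialS_mul (hf : IsSmooth f) (hg : IsSmooth g) (q : ℝ × Circ) :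
    partialS (fun q => f q * g q) q = partialS f q * g q + f q * partialS g q :=
  ((hf.hasDerivAt_partialS q.1 q.2).mul (hg.hasDerivAt_partialS q.1 q.2)).deriv

lemma IsSmooth.partialT_mul (hf : IsSmooth f) (hg : IsSmooth g) (q : ℝ × Circ) :
    partialT (fun q => f q * g q) q = partialT f q * g q + f q * partialT g q := by
  obtain ⟨s, t⟩ := q
  induction t using QuotientAddGroup.induction_on with
  | H t =>
    exact ((hf.mul hg).hasDerivAt_partialT s t).unique
      ((hf.hasDerivAt_partialT s t).mul (hg.hasDerivAt_partialT s t))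

lemma integrable_of_continuous (hg : Continuous g) :
    Integrable (fun z => g (incl z)) stripMeasure :=
  (hg.comp continuous_incl).integrable_of_hasCompactSupport (HasCompactSupport.of_compactSpace _)

lemma integral_intervalMeasure (g : ℝ → ℝ) :
    ∫ s, g (s : ℝ) ∂intervalMeasure = ∫ s in (0 : ℝ)..π, g s := by
  rw [intervalIntegral.integral_of_le pi_pos.le, ← integral_Icc_eq_integral_Ioc]
  exact integral_subtype_comap measurableSet_Icc g

lemma integral_partialS_eq_zero (hf : IsSmooth f) (hzero : ∀ t, f (0, t) = 0)
    (hpi : ∀ t, f (π, t) = 0) : ∫ z, partialS f (incl z) ∂stripMeasure = 0 := by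
  have hint := integrable_of_continuous hf.continuous_partialS
  rw [stripMeasure] at hint ⊢
  rw [integral_prod_symm _ hint]
  refine integral_eq_zero_of_ae (ae_of_all _ fun t => ?_)
  calc ∫ s, partialS f ((s : ℝ), t) ∂intervalMeasure
      = ∫ s in (0 : ℝ)..π, partialS f (s, t) :=
        integral_intervalMeasure fun s => partialS f (s, t)
    _ = f (π, t) - f (0, t) := intervalIntegral.integral_eq_sub_of_hasDerivAt
        (fun s _ => hf.hasDerivAt_partialS s t)
        ((hf.continuous_partialS.comp (by fun_prop :
          Continuous fun s : ℝ => (s, t))).intervalIntegrable _ _)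
    _ = 0 := by rw [hzero, hpi, sub_zero]

lemma integral_partialT_eq_zero (hf : IsSmooth f) :
    ∫ z, partialT f (incl z) ∂stripMeasure = 0 := by
  have hint := integrable_of_continuous hf.continuous_partialT
  rw [stripMeasure] at hint ⊢
  rw [integral_prod _ hint]
  refine integral_eq_zero_of_ae (ae_of_all _ fun s => ?_)
  have hperiod : ((0 + 2 * π : ℝ) : Circ) = ((0 : ℝ) : Circ) := AddCircle.coe_add_period (2 * π) 0
  calc ∫ t : Circ, partialT f ((s : ℝ), t)
      = ∫ t in (0 : ℝ)..(0 + 2 * π), partialT f ((s : ℝ), (t : Circ)) :=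
        (AddCircle.intervalIntegral_preimage (2 * π) 0 fun t => partialT f ((s : ℝ), t)).symm
    _ = f ((s : ℝ), ((0 + 2 * π : ℝ) : Circ)) - f ((s : ℝ), ((0 : ℝ) : Circ)) :=
        intervalIntegral.integral_eq_sub_of_hasDerivAt (f := fun t : ℝ => f ((s : ℝ), (t : Circ)))
          (fun t _ => hf.hasDerivAt_partialT s t)
          ((hf.continuous_partialT.comp (continuous_const.prodMk
            (AddCircle.continuous_mk' (2 * π)))).intervalIntegrable _ _)
    _ = 0 := by rw [hperiod, sub_self]

lemma integral_mul_partialS (hf : IsSmooth f) (hg : IsSmooth g) (hzero : ∀ t, f (0, t) = 0)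
    (hpi : ∀ t, f (π, t) = 0) :
    ∫ z, f (incl z) * partialS g (incl z) ∂stripMeasure =
      -∫ z, partialS f (incl z) * g (incl z) ∂stripMeasure := by
  have hprod := integral_partialS_eq_zero (hf.mul hg) (fun t => by rw [hzero, zero_mul])
    (fun t => by rw [hpi, zero_mul])
  simp only [hf.partialS_mul hg] at hprod
  rw [integral_add (by exact integrable_of_continuous (hf.continuous_partialS.mul hg.continuous))
    (by exact integrable_of_continuous (hf.continuous.mul hg.continuous_partialS))] at hprod
  linarith

lemma integral_mul_partialT (hf : IsSmooth f) (hg : IsSmooth g) :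
    ∫ z, f (incl z) * partialT g (incl z) ∂stripMeasure =
      -∫ z, partialT f (incl z) * g (incl z) ∂stripMeasure := by
  have hprod := integral_partialT_eq_zero (hf.mul hg)
  simp only [hf.partialT_mul hg] at hprod
  rw [integral_add (by exact integrable_of_continuous (hf.continuous_partialT.mul hg.continuous))
    (by exact integrable_of_continuous (hf.continuous.mul hg.continuous_partialT))] at hprod
  linarith

/-- The restriction of a continuous function to the strip, as an element of `L²`. -/
noncomputable def toL2 (f : ℝ × Circ → ℝ) (hf : Continuous f) : L2Strip :=
  ContinuousMap.toLp 2 stripMeasure ℝ ⟨fun z => f (incl z), hf.comp continuous_incl⟩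

lemma coeFn_toL2 (hf : Continuous f) : toL2 f hf =ᵐ[stripMeasure] fun z => f (incl z) :=
  ContinuousMap.coeFn_toLp _ _

lemma integral_toL2_mul (hf : Continuous f) :
    ∫ z, toL2 f hf z * g (incl z) ∂stripMeasure = ∫ z, f (incl z) * g (incl z) ∂stripMeasure := by
  refine integral_congr_ae ?_
  filter_upwards [coeFn_toL2 hf] with z hz
  rw [hz]

lemma inner_toL2 (x : L2Strip) (hf : Continuous f) :
    inner ℝ x (toL2 f hf) = ∫ z, x z * f (incl z) ∂stripMeasure := by
  rw [inner_eq_integral]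
  refine integral_congr_ae ?_
  filter_upwards [coeFn_toL2 hf] with z hz
  rw [hz]

/-- A smooth cut-off function of `s`, supported in `[1/(j+1), π - 1/(j+1)]`, that tends to `1` on
`]0,π[` as `j → ∞`. -/
noncomputable def cutoff (j : ℕ) (s : ℝ) : ℝ :=
  Real.smoothTransition ((j + 1) * s - 1) * Real.smoothTransition ((j + 1) * (π - s) - 1)

lemma contDiff_cutoff (j : ℕ) : ContDiff ℝ ∞ (cutoff j) :=
  (Real.smoothTransition.contDiff.comp (by fun_prop)).mul
    (Real.smoothTransition.contDiff.comp (by fun_prop))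

lemma abs_cutoff_le (j : ℕ) (s : ℝ) : |cutoff j s| ≤ 1 := by
  rw [cutoff, abs_mul, abs_of_nonneg (Real.smoothTransition.nonneg _),
    abs_of_nonneg (Real.smoothTransition.nonneg _)]
  exact mul_le_one₀ (Real.smoothTransition.le_one _) (Real.smoothTransition.nonneg _)
    (Real.smoothTransition.le_one _)

lemma cutoff_eq_zero (j : ℕ) {s : ℝ} (hs : s ∉ Set.Icc (1 / (j + 1) : ℝ) (π - 1 / (j + 1))) :
    cutoff j s = 0 := by
  have hj : (0 : ℝ) < j + 1 := by positivity
  rw [Set.mem_Icc, not_and_or, not_le, not_le] at hs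
  rw [cutoff]
  rcases hs with hs | hs
  · rw [lt_div_iff₀ hj] at hs
    rw [Real.smoothTransition.zero_of_nonpos (by linarith), zero_mul]
  · have hs' : π - s < 1 / (j + 1) := by linarith
    rw [lt_div_iff₀ hj] at hs'
    rw [Real.smoothTransition.zero_of_nonpos (x := (j + 1) * (π - s) - 1) (by linarith), mul_zero]

lemma tendsto_cutoff {s : ℝ} (hs : s ∈ Set.Ioo (0 : ℝ) π) :
    Tendsto (fun j => cutoff j s) atTop (𝓝 1) := by
  have hlarge : ∀ r : ℝ, 0 < r → ∀ᶠ j : ℕ in atTop, 1 ≤ (j + 1 : ℝ) * r - 1 := fun r hr =>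
    (tendsto_atTop_add_const_right _ (-1) ((tendsto_atTop_add_const_right _ 1
      tendsto_natCast_atTop_atTop).atTop_mul_const hr)).eventually_ge_atTop 1
  refine tendsto_const_nhds.congr' ?_
  filter_upwards [hlarge s hs.1, hlarge (π - s) (by linarith [hs.2])] with j hleft hright
  rw [cutoff, Real.smoothTransition.one_of_one_le hleft,
    Real.smoothTransition.one_of_one_le hright, one_mul]

lemma ae_mem_Ioo : ∀ᵐ z ∂stripMeasure, (z.1 : ℝ) ∈ Set.Ioo (0 : ℝ) π := by
  have hInterval : ∀ᵐ s : Set.Icc (0 : ℝ) π ∂intervalMeasure, (s : ℝ) ∈ Set.Ioo (0 : ℝ) π := by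
    rw [intervalMeasure, ae_iff, (MeasurableEmbedding.subtype_coe measurableSet_Icc).comap_apply]
    refine measure_mono_null (t := {0, π}) ?_ ((Set.toFinite _).measure_zero _)
    rintro _ ⟨s, hs, rfl⟩
    by_contra hends
    simp only [Set.mem_insert_iff, Set.mem_singleton_iff, not_or] at hends
    exact hs ⟨lt_of_le_of_ne s.2.1 (Ne.symm hends.1), lt_of_le_of_ne s.2.2 hends.2⟩
  exact Measure.quasiMeasurePreserving_fst.ae hInterval

lemma tendsto_integral_mul_cutoff (y : L2Strip) (hg : Continuous g) :
    Tendsto (fun j : ℕ => ∫ z, y z * (cutoff j (incl z).1 * g (incl z)) ∂stripMeasure) atTop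
      (𝓝 (∫ z, y z * g (incl z) ∂stripMeasure)) := by
  refine tendsto_integral_of_dominated_convergence (fun z => ‖y z * g (incl z)‖)
    (fun j => ?_) (integrable_mul_of_continuous y hg).norm (fun j => ae_of_all _ fun z => ?_) ?_
  · exact (integrable_mul_of_continuous y
      (((contDiff_cutoff j).continuous.comp continuous_fst).mul hg)).aestronglyMeasurable
  · rw [mul_left_comm, norm_mul]
    exact mul_le_of_le_one_left (norm_nonneg _) (abs_cutoff_le j _)
  · filter_upwards [ae_mem_Ioo] with z hz
    simpa only [one_mul, incl] using ((tendsto_cutoff hz).mul_const (g (incl z))).const_mul (y z)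

lemma tsupport_cutoff_mul_subset (j : ℕ) (f : ℝ × Circ → ℝ) :
    tsupport (fun q => cutoff j q.1 * f q) ⊆ Set.Ioo (0 : ℝ) π ×ˢ Set.univ := by
  have hj : (0 : ℝ) < 1 / (j + 1) := by positivity
  have hclosed : IsClosed (Set.Icc (1 / (j + 1) : ℝ) (π - 1 / (j + 1)) ×ˢ (Set.univ : Set Circ)) :=
    isClosed_Icc.prod isClosed_univ
  refine (closure_minimal (fun q hq => ?_) hclosed).trans
    (Set.prod_mono (fun s hs => ⟨by linarith [hs.1], by linarith [hs.2]⟩) le_rfl)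
  by_contra hout
  rw [Set.mem_prod, not_and_or, or_iff_left (not_not.2 (Set.mem_univ _))] at hout
  exact hq (by simp only [cutoff_eq_zero j hout, zero_mul])

/-- The cut-off functions depend on `s` only, hence commute with `∂/∂t`. -/
lemma HasWeakGradient.integral_partialT {x xs xt : L2Strip} (h : HasWeakGradient x xs xt)
    (hf : IsSmooth f) :
    ∫ z, x z * partialT f (incl z) ∂stripMeasure = -∫ z, xt z * f (incl z) ∂stripMeasure := by
  have hcutoff : ∀ j, ∫ z, x z * (cutoff j (incl z).1 * partialT f (incl z)) ∂stripMeasure =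
      -∫ z, xt z * (cutoff j (incl z).1 * f (incl z)) ∂stripMeasure := fun j => by
    have hpartial : ∀ q, partialT (fun q => cutoff j q.1 * f q) q = cutoff j q.1 * partialT f q :=
      fun q => deriv_const_mul_field (cutoff j q.1)
    simpa only [hpartial] using (h (fun q => cutoff j q.1 * f q)
      (((contDiff_cutoff j).comp contDiff_fst).mul hf) (tsupport_cutoff_mul_subset j f)).2
  refine tendsto_nhds_unique (tendsto_integral_mul_cutoff x hf.continuous_partialT) ?_
  simpa only [hcutoff] using (tendsto_integral_mul_cutoff xt hf.continuous).neg

end IntegrationByParts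

section Modes

/-- Indices of the eigenmodes: `((j, n), false)` stands for `φ_{(j+1,n)}` and `((j, n), true)`
for `ψ_{(j+1,n)}`. -/
abbrev ModeIndex : Type := (ℕ × ℕ) × Bool

/-- The frequency `m ≥ 1` in `s`. -/
def freqS (i : ModeIndex) : ℕ := i.1.1 + 1

/-- The frequency `n ≥ 0` in `t`. -/
def freqT (i : ModeIndex) : ℕ := i.1.2

/-- `cos (n t)` for `b = false` and `sin (n t)` for `b = true`. -/
noncomputable def trigT (b : Bool) (n : ℕ) (t : Circ) : ℝ :=
  if b then (fourier (n : ℤ) t : ℂ).im else (fourier (n : ℤ) t : ℂ).re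

lemma trigT_coe (b : Bool) (n : ℕ) (t : ℝ) :
    trigT b n (t : Circ) = if b then Real.sin (n * t) else Real.cos (n * t) := by
  cases b <;> simp only [trigT, fourier_coe_eq, Complex.exp_ofReal_mul_I_re,
    Complex.exp_ofReal_mul_I_im] <;> simp

/-- The sign in the derivative `n ↦ ± n` of `trigT`. -/
def trigSign (b : Bool) : ℝ := if b then 1 else -1

lemma hasDerivAt_trigT (b : Bool) (n : ℕ) (t : Circ) :
    HasDerivAt (fun τ : ℝ => trigT b n (t + (τ : Circ))) (trigSign b * n * trigT (!b) n t) 0 := by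
  induction t using QuotientAddGroup.induction_on with
  | H t =>
    have hlin : HasDerivAt (fun τ : ℝ => n * (t + τ)) (n : ℝ) 0 := by
      simpa using ((hasDerivAt_id (0 : ℝ)).const_add t).const_mul (n : ℝ)
    have hlift : (fun τ : ℝ => trigT b n ((t : Circ) + (τ : Circ))) =
        fun τ : ℝ => if b then Real.sin (n * (t + τ)) else Real.cos (n * (t + τ)) :=
      funext fun τ => trigT_coe b n (t + τ)
    refine hlift ▸ HasDerivAt.congr_deriv ?_ (congrArg _ (trigT_coe (!b) n t)).symm
    cases b
    · exact hlin.cos.congr_deriv (by simp [trigSign, mul_comm])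
    · exact hlin.sin.congr_deriv (by simp [trigSign, mul_comm])

lemma contDiff_trigT (b : Bool) (n : ℕ) :
    ContDiff ℝ ∞ (fun q : ℝ × ℝ => trigT b n (q.2 : Circ)) := by
  simp only [trigT_coe]
  cases b
  · simp only [Bool.false_eq_true, if_false]; fun_prop
  · simp only [if_true]; fun_prop

/-- The eigenmode `φ` or `ψ`, as a function on `ℝ × 𝕋`. -/
noncomputable def modeFun (i : ModeIndex) (q : ℝ × Circ) : ℝ :=
  √2 / π * Real.sin (freqS i * q.1) * trigT i.2 (freqT i) q.2

/-- The derivative of the eigenmode in `s`. -/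
noncomputable def modeFunS (i : ModeIndex) (q : ℝ × Circ) : ℝ :=
  √2 / π * (freqS i * Real.cos (freqS i * q.1)) * trigT i.2 (freqT i) q.2

/-- The derivative of the eigenmode in `t`. -/
noncomputable def modeFunT (i : ModeIndex) (q : ℝ × Circ) : ℝ :=
  √2 / π * Real.sin (freqS i * q.1) * (trigSign i.2 * freqT i * trigT (!i.2) (freqT i) q.2)

lemma isSmooth_modeFun (i : ModeIndex) : IsSmooth (modeFun i) :=
  ContDiff.mul (by fun_prop) (contDiff_trigT _ _)

lemma isSmooth_modeFunS (i : ModeIndex) : IsSmooth (modeFunS i) :=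
  ContDiff.mul (by fun_prop) (contDiff_trigT _ _)

lemma isSmooth_modeFunT (i : ModeIndex) : IsSmooth (modeFunT i) :=
  ContDiff.mul (by fun_prop) (ContDiff.mul contDiff_const (contDiff_trigT _ _))

lemma partialS_modeFun (i : ModeIndex) : partialS (modeFun i) = modeFunS i := by
  funext q
  have hderiv := (((hasDerivAt_const_mul (freqS i : ℝ) (x := q.1)).sin).const_mul
    (√2 / π)).mul_const (trigT i.2 (freqT i) q.2)
  refine hderiv.deriv.trans ?_
  rw [modeFunS]; ring

lemma partialS_modeFunS (i : ModeIndex) (q : ℝ × Circ) :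
    partialS (modeFunS i) q = -((freqS i : ℝ) ^ 2 * modeFun i q) := by
  have hderiv := ((((hasDerivAt_const_mul (freqS i : ℝ) (x := q.1)).cos).const_mul
    (freqS i : ℝ)).const_mul (√2 / π)).mul_const (trigT i.2 (freqT i) q.2)
  refine hderiv.deriv.trans ?_
  rw [modeFun]; ring

lemma partialT_modeFun (i : ModeIndex) : partialT (modeFun i) = modeFunT i := by
  funext q
  exact ((hasDerivAt_trigT i.2 (freqT i) q.2).const_mul
    (√2 / π * Real.sin (freqS i * q.1))).deriv

lemma trigSign_mul_not (b : Bool) : trigSign b * trigSign (!b) = -1 := by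
  cases b <;> simp [trigSign]

lemma partialT_modeFunT (i : ModeIndex) (q : ℝ × Circ) :
    partialT (modeFunT i) q = -((freqT i : ℝ) ^ 2 * modeFun i q) := by
  have hderiv := ((hasDerivAt_trigT (!i.2) (freqT i) q.2).const_mul
    (trigSign i.2 * freqT i)).const_mul (√2 / π * Real.sin (freqS i * q.1))
  refine hderiv.deriv.trans ?_
  rw [modeFun, Bool.not_not]
  linear_combination (√2 / π * Real.sin (freqS i * q.1) * freqT i ^ 2 *
    trigT i.2 (freqT i) q.2) * trigSign_mul_not i.2

lemma modeFun_zero (i : ModeIndex) (t : Circ) : modeFun i (0, t) = 0 := by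
  simp [modeFun]

lemma modeFun_pi (i : ModeIndex) (t : Circ) : modeFun i (π, t) = 0 := by
  simp [modeFun, Real.sin_nat_mul_pi]

/-- The eigenmode `φ` or `ψ` in `L²`. -/
noncomputable def mode (i : ModeIndex) : L2Strip := toL2 (modeFun i) (isSmooth_modeFun i).continuous

/-- The derivative in `s` of the eigenmode, in `L²`. -/
noncomputable def modeS (i : ModeIndex) : L2Strip :=
  toL2 (modeFunS i) (isSmooth_modeFunS i).continuous

/-- The derivative in `t` of the eigenmode, in `L²`. -/
noncomputable def modeT (i : ModeIndex) : L2Strip :=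
  toL2 (modeFunT i) (isSmooth_modeFunT i).continuous

lemma phi_eq_mode (j n : ℕ) : phi (j + 1) n = mode ((j, n), false) := rfl

lemma psi_eq_mode (j n : ℕ) : psi (j + 1) n = mode ((j, n), true) := rfl

lemma hasZeroTrace_mode (i : ModeIndex) : HasZeroTrace (mode i) (modeS i) := by
  intro f hf
  rw [mode, modeS, integral_toL2_mul, integral_toL2_mul,
    integral_mul_partialS (isSmooth_modeFun i) hf (modeFun_zero i) (modeFun_pi i),
    partialS_modeFun]

lemma hasWeakGradient_mode (i : ModeIndex) : HasWeakGradient (mode i) (modeS i) (modeT i) := by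
  refine fun f hf _ => ⟨hasZeroTrace_mode i f hf, ?_⟩
  rw [mode, modeT, integral_toL2_mul, integral_toL2_mul,
    integral_mul_partialT (isSmooth_modeFun i) hf, partialT_modeFun]

lemma HasZeroTrace.inner_modeS {x xs : L2Strip} (h : HasZeroTrace x xs) (i : ModeIndex) :
    inner ℝ xs (modeS i) = (freqS i : ℝ) ^ 2 * inner ℝ x (mode i) := by
  have hgreen := h _ (isSmooth_modeFunS i)
  simp only [partialS_modeFunS, mul_neg, integral_neg, neg_inj, mul_left_comm (x _),
    integral_const_mul] at hgreen
  rw [modeS, mode, inner_toL2, inner_toL2, hgreen]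

lemma HasWeakGradient.inner_modeT {x xs xt : L2Strip} (h : HasWeakGradient x xs xt)
    (i : ModeIndex) : inner ℝ xt (modeT i) = (freqT i : ℝ) ^ 2 * inner ℝ x (mode i) := by
  have hgreen := h.integral_partialT (isSmooth_modeFunT i)
  simp only [partialT_modeFunT, mul_neg, integral_neg, neg_inj, mul_left_comm (x _),
    integral_const_mul] at hgreen
  rw [modeT, mode, inner_toL2, inner_toL2, hgreen]

lemma inner_mode_false_true (p : ℕ × ℕ) : inner ℝ (mode (p, false)) (mode (p, true)) = 0 := by
  rw [mode, mode, inner_toL2, integral_toL2_mul]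
  by_cases hn : p.2 = 0
  · simp [modeFun, freqT, hn, trigT]
  have hderiv : ∀ q, modeFunT (p, false) q = -(p.2 : ℝ) * modeFun (p, true) q := fun q => by
    simp only [modeFunT, modeFun, freqT, freqS, trigSign, Bool.not_false, Bool.false_eq_true,
      if_false]
    ring
  -- `∬ φ φ_t = 0` by periodicity in `t`, and `φ_t = -n ψ`.
  have hparts := integral_mul_partialT (isSmooth_modeFun (p, false)) (isSmooth_modeFun (p, false))
  simp only [partialT_modeFun, mul_comm (modeFunT _ _), self_eq_neg] at hparts
  simpa only [hderiv, mul_left_comm (modeFun _ _), integral_const_mul, mul_eq_zero, neg_eq_zero,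
    Nat.cast_eq_zero, hn, false_or] using hparts

lemma eq_zero_of_natCast_sq_mul_eq {m n : ℕ} {r : ℝ} (hmn : m ≠ n)
    (h : (m : ℝ) ^ 2 * r = (n : ℝ) ^ 2 * r) : r = 0 := by
  by_contra hr
  have hsq : (m : ℝ) ^ 2 = (n : ℝ) ^ 2 := mul_right_cancel₀ hr h
  exact hmn (by exact_mod_cast (pow_left_inj₀ m.cast_nonneg n.cast_nonneg two_ne_zero).1 hsq)

lemma inner_mode_of_ne {i j : ModeIndex} (hij : i ≠ j) : inner ℝ (mode i) (mode j) = 0 := by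
  by_cases hS : freqS i = freqS j
  · by_cases hT : freqT i = freqT j
    · obtain ⟨p, b⟩ := i
      obtain ⟨p', b'⟩ := j
      obtain rfl : p = p' := Prod.ext (Nat.succ_injective hS) hT
      cases b <;> cases b'
      · exact absurd rfl hij
      · exact inner_mode_false_true p
      · rw [real_inner_comm]; exact inner_mode_false_true p
      · exact absurd rfl hij
    · refine eq_zero_of_natCast_sq_mul_eq hT ?_
      rw [← (hasWeakGradient_mode i).inner_modeT j, real_inner_comm, real_inner_comm (modeT j),
        (hasWeakGradient_mode j).inner_modeT i]
  · refine eq_zero_of_natCast_sq_mul_eq hS ?_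
    rw [← (hasZeroTrace_mode i).inner_modeS j, real_inner_comm, real_inner_comm (modeS j),
      (hasZeroTrace_mode j).inner_modeS i]

end Modes

section Resolvent

/-- Indices of the nonzero eigenmodes; `ψ_{(m,0)} = 0` is left out. -/
abbrev NonzeroIndex : Type := {i : ModeIndex // mode i ≠ 0}

/-- The normalized eigenmodes. -/
noncomputable def unitMode (i : NonzeroIndex) : L2Strip := ‖mode i‖⁻¹ • mode i

/-- The eigenvalue `m² - n²` of the mode. -/
def modeEig (i : ModeIndex) : ℝ := (freqS i : ℝ) ^ 2 - (freqT i : ℝ) ^ 2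

/-- The multipliers of `(c - □)⁻¹`; meaningful only if `c` is not an eigenvalue. -/
noncomputable def resolventMul (c : ℝ) (i : NonzeroIndex) : ℝ := (c - modeEig i)⁻¹

lemma orthonormal_unitMode : Orthonormal ℝ unitMode := by
  refine ⟨fun i => ?_, fun i j hij => ?_⟩
  · rw [unitMode, norm_smul, norm_inv, norm_norm, inv_mul_cancel₀ (norm_ne_zero_iff.2 i.2)]
  · simp only [unitMode]
    rw [inner_smul_left, inner_smul_right, inner_mode_of_ne (Subtype.coe_ne_coe.2 hij),
      mul_zero, mul_zero]

lemma inner_unitMode (i : NonzeroIndex) (v : L2Strip) :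
    inner ℝ (unitMode i) v = ‖mode i‖⁻¹ * inner ℝ (mode i) v :=
  real_inner_smul_left _ _ _

lemma inner_mode_eq_zero {w : L2Strip} {i : ModeIndex}
    (h : ∀ hi : mode i ≠ 0, inner ℝ (unitMode ⟨i, hi⟩) w = 0) : inner ℝ w (mode i) = 0 := by
  by_cases hi : mode i = 0
  · rw [hi, inner_zero_right]
  · have hcoeff := h hi
    rw [inner_unitMode, mul_eq_zero, inv_eq_zero, norm_eq_zero] at hcoeff
    exact (real_inner_comm _ _).trans (hcoeff.resolve_left hi)

lemma coeff_smul_mode (i : NonzeroIndex) (v : L2Strip) :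
    coeff (mode i) v • mode i = inner ℝ (unitMode i) v • unitMode i := by
  rw [inner_unitMode, coeff, unitMode, smul_smul]
  congr 1
  field_simp

theorem resolventOp_eq_diagOp {c B : ℝ} (hB : ∀ i, |resolventMul c i| ≤ B) (v : L2Strip) :
    resolventOp c v = diagOp unitMode (resolventMul c) v := by
  set F : ModeIndex → L2Strip := fun i => (c - modeEig i)⁻¹ • (coeff (mode i) v • mode i) with hF
  have hsum : HasSum (F ∘ ((↑) : {i | mode i ≠ 0} → ModeIndex))
      (diagOp unitMode (resolventMul c) v) :=
    (hasSum_diagOp orthonormal_unitMode hB v).congr_fun fun i => by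
      rw [hF, Function.comp_apply, coeff_smul_mode, smul_smul, resolventMul]
  have hsupport : Function.support F ⊆ {i | mode i ≠ 0} := fun i hi hzero =>
    hi (by simp only [hF, hzero, smul_zero])
  rw [hasSum_subtype_iff_of_support_subset hsupport] at hsum
  have hpairs : HasSum (fun p : ℕ × ℕ => ∑ b : Bool, F (p, b))
      (diagOp unitMode (resolventMul c) v) :=
    hsum.prod_fiberwise fun p => hasSum_fintype _
  rw [resolventOp, ← hpairs.tsum_eq]
  refine tsum_congr fun p => ?_
  rw [Fintype.sum_bool, phi_eq_mode, psi_eq_mode, smul_add, sub_add]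
  exact add_comm _ _

lemma summable_of_orthogonal {H ι : Type*} [NormedAddCommGroup H] [InnerProductSpace ℝ H]
    [CompleteSpace H] {f : ι → H} (hf : ∀ i j, i ≠ j → inner ℝ (f i) (f j) = 0)
    (hs : Summable fun i => ‖f i‖ ^ 2) : Summable f := by
  have hV : OrthogonalFamily ℝ (fun i => Submodule.span ℝ {f i})
      (fun i => (Submodule.span ℝ {f i}).subtypeₗᵢ) := by
    rintro i j hij ⟨v, hv⟩ ⟨w, hw⟩
    obtain ⟨a, rfl⟩ := Submodule.mem_span_singleton.1 hv
    obtain ⟨b, rfl⟩ := Submodule.mem_span_singleton.1 hw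
    simp [real_inner_smul_left, real_inner_smul_right, hf i j hij]
  exact (hV.summable_iff_norm_sq_summable
    (f := fun i => ⟨f i, Submodule.mem_span_singleton_self _⟩)).2 (by simpa using hs)

lemma isClosed_sobolevSpace : IsClosed (sobolevSpace : Set (L2Strip × L2Strip × L2Strip)) := by
  have hGreen : ∀ {f g : ℝ × Circ → ℝ} (_ : Continuous f) (_ : Continuous g)
      {a b : L2Strip × L2Strip × L2Strip → L2Strip} (_ : Continuous a) (_ : Continuous b),
      IsClosed {w | ∫ z, a w z * f (incl z) ∂stripMeasure =
        -∫ z, b w z * g (incl z) ∂stripMeasure} := by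
    intro f g hf hg a b ha hb
    simp only [← inner_toL2 _ hf, ← inner_toL2 _ hg]
    exact isClosed_eq (ha.inner continuous_const) (hb.inner continuous_const).neg
  have hRange : IsClosed {w : L2Strip × L2Strip × L2Strip | w.1 ∈ rangeSpace} :=
    (Submodule.isClosed_topologicalClosure _).preimage continuous_fst
  have hGradient :
      IsClosed {w : L2Strip × L2Strip × L2Strip | HasWeakGradient w.1 w.2.1 w.2.2} := by
    simp only [HasWeakGradient, Set.ofPred_forall, Set.ofPred_and]
    refine isClosed_iInter fun f => isClosed_iInter fun hf => isClosed_iInter fun _ => ?_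
    exact (hGreen hf.continuous_partialS hf.continuous (by fun_prop) (by fun_prop)).inter
      (hGreen hf.continuous_partialT hf.continuous (by fun_prop) (by fun_prop))
  have hTrace : IsClosed {w : L2Strip × L2Strip × L2Strip | HasZeroTrace w.1 w.2.1} := by
    simp only [HasZeroTrace, Set.ofPred_forall]
    refine isClosed_iInter fun f => isClosed_iInter fun hf => ?_
    exact hGreen hf.continuous_partialS hf.continuous (by fun_prop) (by fun_prop)
  exact hRange.inter (hGradient.inter hTrace)

lemma mode_mem_rangeSpace {i : ModeIndex} (hi : freqS i ≠ freqT i) : mode i ∈ rangeSpace := by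
  obtain ⟨⟨j, n⟩, b⟩ := i
  refine Submodule.le_topologicalClosure _ (Submodule.subset_span ⟨j + 1, n, by omega, hi, ?_⟩)
  cases b
  · exact Or.inl (phi_eq_mode j n).symm
  · exact Or.inr (psi_eq_mode j n).symm

lemma mode_mem_kernelSpace {i : ModeIndex} (hi : freqS i = freqT i) : mode i ∈ kernelSpace := by
  obtain ⟨⟨j, n⟩, b⟩ := i
  obtain rfl : j + 1 = n := hi
  refine Submodule.le_topologicalClosure _ (Submodule.subset_span ⟨j + 1, by omega, ?_⟩)
  cases b
  · exact Or.inl (phi_eq_mode j _).symm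
  · exact Or.inr (psi_eq_mode j _).symm

lemma mode_mem_sobolevSpace {i : ModeIndex} (hi : freqS i ≠ freqT i) :
    (mode i, modeS i, modeT i) ∈ sobolevSpace :=
  ⟨mode_mem_rangeSpace hi, hasWeakGradient_mode i, hasZeroTrace_mode i⟩

lemma inner_eq_zero_of_mem_closure_span {H : Type*} [NormedAddCommGroup H] [InnerProductSpace ℝ H]
    {S : Set H} {w x : H} (hS : ∀ e ∈ S, inner ℝ w e = 0)
    (hx : x ∈ (Submodule.span ℝ S).topologicalClosure) : inner ℝ w x = 0 := by
  refine Submodule.mem_orthogonal_singleton_iff_inner_right.1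
    (Submodule.topologicalClosure_minimal _ (Submodule.span_le.2 fun e he => ?_)
      (Submodule.isClosed_orthogonal _) hx)
  exact Submodule.mem_orthogonal_singleton_iff_inner_right.2 (hS e he)

lemma inner_eq_zero_of_mem_rangeSpace {w x : L2Strip}
    (hw : ∀ i, freqS i ≠ freqT i → inner ℝ w (mode i) = 0) (hx : x ∈ rangeSpace) :
    inner ℝ w x = 0 := by
  refine inner_eq_zero_of_mem_closure_span ?_ hx
  rintro e ⟨m, n, hm, hmn, he⟩
  obtain ⟨j, rfl⟩ := Nat.exists_eq_add_of_le' hm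
  rcases he with rfl | rfl
  · exact hw ((j, n), false) hmn
  · exact hw ((j, n), true) hmn

lemma inner_eq_zero_of_mem_kernelSpace {w x : L2Strip}
    (hw : ∀ i, freqS i = freqT i → inner ℝ w (mode i) = 0) (hx : x ∈ kernelSpace) :
    inner ℝ w x = 0 := by
  refine inner_eq_zero_of_mem_closure_span ?_ hx
  rintro e ⟨m, hm, he⟩
  obtain ⟨j, rfl⟩ := Nat.exists_eq_add_of_le' hm
  rcases he with rfl | rfl
  · exact hw ((j, j + 1), false) rfl
  · exact hw ((j, j + 1), true) rfl

lemma add_freq_le_abs_modeEig {i : ModeIndex} (hi : freqS i ≠ freqT i) :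
    (freqS i : ℝ) + freqT i ≤ |modeEig i| := by
  have hdist : (1 : ℝ) ≤ |(freqS i : ℝ) - freqT i| := by
    have hint : (1 : ℤ) ≤ |(freqS i : ℤ) - freqT i| :=
      Int.one_le_abs (sub_ne_zero.2 (by exact_mod_cast hi))
    exact_mod_cast hint
  have hsum : (0 : ℝ) ≤ (freqS i : ℝ) + freqT i := by positivity
  rw [modeEig, sq_sub_sq, abs_mul, abs_of_nonneg hsum]
  exact le_mul_of_one_le_right hsum hdist

/-- The coefficients along the modes with `m ≠ n` of `∑ αᵢ eᵢ`, where `eᵢ = unitMode i`: these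
give the component in `ℛ`, expanded in the modes before normalization. -/
noncomputable def rangeCoeff (α : NonzeroIndex → ℝ) (i : NonzeroIndex) : ℝ :=
  if freqS i = freqT i then 0 else α i * ‖mode i‖⁻¹

section

variable {α : NonzeroIndex → ℝ} {i : NonzeroIndex}

lemma rangeCoeff_of_eq (hi : freqS i = freqT i) : rangeCoeff α i = 0 := if_pos hi

lemma rangeCoeff_of_ne (hi : freqS i ≠ freqT i) : rangeCoeff α i = α i * ‖mode i‖⁻¹ := if_neg hi

lemma summable_rangeCoeff_smul (hα : Summable fun i : NonzeroIndex => (modeEig i * α i) ^ 2)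
    {f : ModeIndex → L2Strip} {r : ModeIndex → ℝ} (hr : ∀ i, 0 ≤ r i ∧ r i ≤ freqS i + freqT i)
    (hf : ∀ i j, inner ℝ (f i) (f j) = r j ^ 2 * inner ℝ (mode i) (mode j)) :
    Summable fun i : NonzeroIndex => rangeCoeff α i • f i := by
  refine summable_of_orthogonal (fun i j hij => ?_) ?_
  · rw [real_inner_smul_left, real_inner_smul_right, hf,
      inner_mode_of_ne fun h => hij (Subtype.ext h)]
    ring
  refine Summable.of_nonneg_of_le (fun i => sq_nonneg _) (fun i => ?_) hα
  have hnorm : ‖f i‖ ^ 2 = r i ^ 2 * ‖mode i‖ ^ 2 := by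
    rw [← real_inner_self_eq_norm_sq, hf, real_inner_self_eq_norm_sq]
  rw [norm_smul, mul_pow, hnorm, Real.norm_eq_abs, sq_abs]
  by_cases hi : freqS i = freqT i
  · rw [rangeCoeff_of_eq hi]
    nlinarith [sq_nonneg (modeEig i * α i)]
  · have hfreq : r i ^ 2 ≤ modeEig i ^ 2 := by
      rw [← sq_abs (modeEig i)]
      exact pow_le_pow_left₀ (hr i).1 ((hr i).2.trans (add_freq_le_abs_modeEig hi)) 2
    have hcancel : ‖mode i‖⁻¹ * ‖mode i‖ = 1 := inv_mul_cancel₀ (norm_ne_zero_iff.2 i.2)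
    calc rangeCoeff α i ^ 2 * (r i ^ 2 * ‖mode i‖ ^ 2)
        = r i ^ 2 * α i ^ 2 * (‖mode i‖⁻¹ * ‖mode i‖) ^ 2 := by rw [rangeCoeff_of_ne hi]; ring
      _ ≤ (modeEig i * α i) ^ 2 := by
        rw [hcancel, one_pow, mul_one, mul_pow]
        exact mul_le_mul_of_nonneg_right hfreq (sq_nonneg _)

lemma exists_hasSum_rangeCoeff (hα : Summable fun i : NonzeroIndex => (modeEig i * α i) ^ 2) :
    ∃ w ∈ sobolevSpace, HasSum (fun i : NonzeroIndex => rangeCoeff α i • mode i) w.1 ∧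
      HasSum (fun i : NonzeroIndex => rangeCoeff α i • modeS i) w.2.1 ∧
      HasSum (fun i : NonzeroIndex => rangeCoeff α i • modeT i) w.2.2 := by
  have hmode := (summable_rangeCoeff_smul hα (r := fun _ => 1) (f := mode)
    (fun i => ⟨zero_le_one, by
      rw [freqS, Nat.cast_add_one]; linarith [i.1.1.cast_nonneg (α := ℝ),
        (freqT i).cast_nonneg (α := ℝ)]⟩) fun i j => by ring).hasSum
  have hmodeS := (summable_rangeCoeff_smul hα (f := modeS)
    (fun i => ⟨Nat.cast_nonneg _, le_add_of_nonneg_right (Nat.cast_nonneg _)⟩)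
    fun i j => (hasZeroTrace_mode i).inner_modeS j).hasSum
  have hmodeT := (summable_rangeCoeff_smul hα (f := modeT)
    (fun i => ⟨Nat.cast_nonneg _, le_add_of_nonneg_left (Nat.cast_nonneg _)⟩)
    fun i j => (hasWeakGradient_mode i).inner_modeT j).hasSum
  refine ⟨(_, _, _), isClosed_sobolevSpace.mem_of_tendsto
    (hmode.prodMk (hmodeS.prodMk hmodeT)) (Eventually.of_forall fun F => ?_), hmode, hmodeS, hmodeT⟩
  refine sobolevSpace.sum_mem fun i _ => ?_
  by_cases hi : freqS i = freqT i
  · simp only [rangeCoeff_of_eq hi, zero_smul]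
    exact sobolevSpace.zero_mem
  · exact sobolevSpace.smul_mem _ (mode_mem_sobolevSpace hi)

lemma sub_mem_kernelSpace {u x : L2Strip} (hu : HasSum (fun i => α i • unitMode i) u)
    (hx : HasSum (fun i : NonzeroIndex => rangeCoeff α i • mode i) x) : u - x ∈ kernelSpace := by
  refine (Submodule.isClosed_topologicalClosure _).mem_of_tendsto (hu.sub hx)
    (Eventually.of_forall fun F => kernelSpace.sum_mem fun i _ => ?_)
  by_cases hi : freqS i = freqT i
  · rw [rangeCoeff_of_eq hi, zero_smul, sub_zero, unitMode]
    exact kernelSpace.smul_mem _ (kernelSpace.smul_mem _ (mode_mem_kernelSpace hi))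
  · rw [rangeCoeff_of_ne hi, unitMode, smul_smul, sub_self]
    exact kernelSpace.zero_mem

lemma rangeCoeff_mul_inner_grad (α : NonzeroIndex → ℝ) (i : NonzeroIndex)
    (d : sobolevSpace × kernelSpace) :
    rangeCoeff α i * inner ℝ (d.1 : L2Strip × L2Strip × L2Strip).2.1 (modeS i)
        - rangeCoeff α i * inner ℝ (d.1 : L2Strip × L2Strip × L2Strip).2.2 (modeT i) =
      modeEig i * α i * inner ℝ (unitMode i) (toFunction d) := by
  obtain ⟨⟨⟨x, xs, xt⟩, -, hgrad, htrace⟩, y, hy⟩ := d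
  rw [HasZeroTrace.inner_modeS htrace, HasWeakGradient.inner_modeT hgrad, toFunction,
    inner_unitMode, modeEig]
  by_cases hi : freqS i = freqT i
  · rw [rangeCoeff_of_eq hi, hi]; ring
  · have hker : inner ℝ (mode i) y = 0 := inner_eq_zero_of_mem_kernelSpace
      (fun j hj => inner_mode_of_ne fun hij => hi (hij ▸ hj)) hy
    rw [rangeCoeff_of_ne hi, inner_add_right, hker, real_inner_comm x]
    ring

lemma hasSum_inner_unitMode_mul (g : L2Strip) (d : sobolevSpace × kernelSpace) :
    HasSum (fun i => inner ℝ (unitMode i) g * inner ℝ (unitMode i) (toFunction d))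
      (inner ℝ g (toFunction d)) := by
  have hone : ∀ i : NonzeroIndex, |(fun _ => (1 : ℝ)) i| ≤ 1 := fun i => abs_one.le
  have hproj : ∀ i, inner ℝ (g - diagOp unitMode (fun _ => 1) g) (mode i) = 0 := fun i =>
    inner_mode_eq_zero fun hi => by
      rw [inner_sub_right, inner_diagOp orthonormal_unitMode hone, one_mul, sub_self]
  have hperp : inner ℝ (g - diagOp unitMode (fun _ => 1) g) (toFunction d) = 0 := by
    rw [toFunction, inner_add_right,
      inner_eq_zero_of_mem_rangeSpace (fun i _ => hproj i) d.1.2.1,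
      inner_eq_zero_of_mem_kernelSpace (fun i _ => hproj i) d.2.2, add_zero]
  rw [inner_sub_left, sub_eq_zero] at hperp
  rw [hperp]
  exact (hasSum_inner_diagOp orthonormal_unitMode hone g _).congr_fun fun i => by rw [one_mul]

end

lemma modeEig_mul_resolventMul {c : ℝ} {i : NonzeroIndex} (hc : c ≠ modeEig i) :
    modeEig i * resolventMul c i = c * resolventMul c i - 1 := by
  have hne : c - modeEig i ≠ 0 := sub_ne_zero.2 hc
  rw [resolventMul]
  field_simp
  ring

theorem exists_toFunction_eq_diagOp_resolventMul {c B : ℝ}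
    (hc : ∀ i : NonzeroIndex, c ≠ modeEig i) (hB : ∀ i, |resolventMul c i| ≤ B) (v : L2Strip) :
    ∃ w : sobolevSpace × kernelSpace, toFunction w = diagOp unitMode (resolventMul c) v ∧
      ∀ d : sobolevSpace × kernelSpace,
        inner ℝ (w.1 : L2Strip × L2Strip × L2Strip).2.1 (d.1 : L2Strip × L2Strip × L2Strip).2.1
          - inner ℝ (w.1 : L2Strip × L2Strip × L2Strip).2.2
              (d.1 : L2Strip × L2Strip × L2Strip).2.2 =
        inner ℝ (c • toFunction w - v) (toFunction d) := by
  set u := diagOp unitMode (resolventMul c) v with hu_def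
  set α : NonzeroIndex → ℝ := fun i => resolventMul c i * inner ℝ (unitMode i) v
  have hcoeff : ∀ i, inner ℝ (unitMode i) (c • u - v) = modeEig i * α i := fun i => by
    rw [inner_sub_right, inner_smul_right, hu_def, inner_diagOp orthonormal_unitMode hB]
    linear_combination -(inner ℝ (unitMode i) v) * modeEig_mul_resolventMul (hc i)
  have hα : Summable fun i : NonzeroIndex => (modeEig i * α i) ^ 2 := by
    simpa only [hcoeff] using summable_inner_sq orthonormal_unitMode (c • u - v)
  have hu : HasSum (fun i => α i • unitMode i) u := hasSum_diagOp orthonormal_unitMode hB v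
  obtain ⟨⟨x, xs, xt⟩, hmem, hx, hxs, hxt⟩ := exists_hasSum_rangeCoeff hα
  refine ⟨(⟨(x, xs, xt), hmem⟩, ⟨u - x, sub_mem_kernelSpace hu hx⟩),
    by rw [toFunction, add_sub_cancel], fun d => ?_⟩
  have hform := (hxs.mapL (innerSL ℝ (d.1 : L2Strip × L2Strip × L2Strip).2.1)).sub
    (hxt.mapL (innerSL ℝ (d.1 : L2Strip × L2Strip × L2Strip).2.2))
  simp only [innerSL_apply_apply, inner_smul_right, rangeCoeff_mul_inner_grad] at hform
  simp only [toFunction, add_sub_cancel]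
  rw [real_inner_comm, real_inner_comm (d.1 : L2Strip × L2Strip × L2Strip).2.2]
  exact hform.unique ((hasSum_inner_unitMode_mul (c • u - v) d).congr_fun fun i => by rw [hcoeff])

end Resolvent

section SpectralGap

lemma isWaveEigenvalue_odd (j : ℕ) : IsWaveEigenvalue ((2 * j + 1 : ℕ) : ℤ) :=
  ⟨j + 1, j, by lia, by push_cast; ring⟩

lemma isWaveEigenvalue_neg_odd (j : ℕ) : IsWaveEigenvalue (-((2 * (j + 1) + 1 : ℕ) : ℤ)) :=
  ⟨j + 1, j + 2, by lia, by push_cast; ring⟩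

lemma isWaveEigenvalue_zero : IsWaveEigenvalue 0 := ⟨1, 1, le_rfl, by ring⟩

lemma infinite_setOf_isWaveEigenvalue_natCast : {j : ℕ | IsWaveEigenvalue j}.Infinite :=
  Set.infinite_of_injective_forall_mem (f := fun j : ℕ => 2 * j + 1)
    (fun i j h => by simpa using h) isWaveEigenvalue_odd

lemma infinite_setOf_isWaveEigenvalue_neg_natCast : {j : ℕ | IsWaveEigenvalue (-j)}.Infinite :=
  Set.infinite_of_injective_forall_mem (f := fun j : ℕ => 2 * (j + 1) + 1)
    (fun i j h => by simpa using h) isWaveEigenvalue_neg_odd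

lemma le_nth_or_nth_succ_le {P : ℕ → Prop} (hP : {j | P j}.Infinite) {j : ℕ} (hj : P j)
    (n : ℕ) : j ≤ Nat.nth P n ∨ Nat.nth P (n + 1) ≤ j := by
  classical
  rw [← Nat.nth_count hj, Nat.nth_le_nth hP, Nat.nth_le_nth hP]
  lia

lemma eigInt_natCast (n : ℕ) : eigInt n = Nat.nth (fun j : ℕ => IsWaveEigenvalue j) n := rfl

lemma eigInt_neg_natCast (n : ℕ) :
    eigInt (-n) = -(Nat.nth (fun j : ℕ => IsWaveEigenvalue (-j)) n : ℤ) := by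
  cases n with
  | zero =>
    have hnonneg : Nat.nth (fun j : ℕ => IsWaveEigenvalue j) 0 = 0 :=
      Nat.nth_zero_of_zero isWaveEigenvalue_zero
    have hnonpos : Nat.nth (fun j : ℕ => IsWaveEigenvalue (-j)) 0 = 0 :=
      Nat.nth_zero_of_zero (by simpa using isWaveEigenvalue_zero)
    rw [hnonpos, Nat.cast_zero, neg_zero, ← Nat.cast_zero, eigInt_natCast, hnonneg]
  | succ n => rfl

theorem le_eigInt_or_eigInt_succ_le (k : ℤ) {z : ℤ} (hz : IsWaveEigenvalue z) :
    z ≤ eigInt k ∨ eigInt (k + 1) ≤ z := by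
  obtain ⟨n, rfl | rfl⟩ : ∃ n : ℕ, k = n ∨ k = -((n + 1 : ℕ) : ℤ) := by
    rcases le_or_gt 0 k with hk | hk
    · exact ⟨k.toNat, Or.inl (by lia)⟩
    · exact ⟨(-k - 1).toNat, Or.inr (by lia)⟩
  · rw [← Nat.cast_succ, eigInt_natCast, eigInt_natCast]
    rcases le_total z 0 with hneg | hpos
    · exact Or.inl (hneg.trans (by positivity))
    · lift z to ℕ using hpos
      exact_mod_cast le_nth_or_nth_succ_le infinite_setOf_isWaveEigenvalue_natCast hz n
  · have hsucc : -((n + 1 : ℕ) : ℤ) + 1 = -(n : ℤ) := by push_cast; ring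
    rw [hsucc, eigInt_neg_natCast, eigInt_neg_natCast]
    rcases le_total 0 z with hpos | hneg
    · exact Or.inr (le_trans (by simp) hpos)
    · obtain ⟨j, rfl⟩ : ∃ j : ℕ, z = -(j : ℤ) := ⟨(-z).toNat, by lia⟩
      have hgap := le_nth_or_nth_succ_le infinite_setOf_isWaveEigenvalue_neg_natCast hz n
      lia

lemma modeEig_le_eig_or_eig_succ_le (k : ℤ) (i : ModeIndex) :
    modeEig i ≤ eig k ∨ eig (k + 1) ≤ modeEig i := by
  have heig : IsWaveEigenvalue ((freqS i : ℤ) ^ 2 - (freqT i : ℤ) ^ 2) :=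
    ⟨freqS i, freqT i, by unfold freqS; lia, rfl⟩
  have hgap := le_eigInt_or_eigInt_succ_le k heig
  rw [modeEig, eig, eig]
  exact_mod_cast hgap

lemma eig_succ_nonpos {k : ℤ} (hk : eig k < 0) : eig (k + 1) ≤ 0 := by
  rw [eig] at hk ⊢
  exact_mod_cast (le_eigInt_or_eigInt_succ_le k isWaveEigenvalue_zero).resolve_left
    (not_le.2 (by exact_mod_cast hk))

/-- `c` lies in the spectral gap above `λ_k`. -/
def InGap (k : ℤ) (c : ℝ) : Prop := eig k < c ∧ c < eig (k + 1)

/-- An upper bound for the norm of `(c - □)⁻¹` when `c` lies in the spectral gap above `λ_k`. -/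
noncomputable def gapBound (k : ℤ) (c : ℝ) : ℝ := 1 / min (c - eig k) (eig (k + 1) - c)

lemma min_sub_eig_le_abs_sub_modeEig (k : ℤ) (c : ℝ) (i : ModeIndex) :
    min (c - eig k) (eig (k + 1) - c) ≤ |c - modeEig i| := by
  rcases modeEig_le_eig_or_eig_succ_le k i with h | h
  · exact (min_le_left _ _).trans ((sub_le_sub_left h c).trans (le_abs_self _))
  · rw [abs_sub_comm]
    exact (min_le_right _ _).trans ((sub_le_sub_right h c).trans (le_abs_self _))

lemma finite_setOf_freq_le (N : ℝ) :
    {i : NonzeroIndex | (freqS i.1 : ℝ) + freqT i.1 ≤ N}.Finite := by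
  suffices {i : ModeIndex | (freqS i : ℝ) + freqT i ≤ N}.Finite from
    this.preimage Subtype.val_injective.injOn
  obtain ⟨n, hn⟩ := exists_nat_ge N
  refine (((Set.finite_Iic n).prod (Set.finite_Iic n)).prod
    (Set.finite_univ (α := Bool))).subset ?_
  rintro ⟨⟨j, l⟩, b⟩ hi
  have hsum : j + 1 + l ≤ n := by
    have : ((j + 1 : ℕ) : ℝ) + (l : ℝ) ≤ n := le_trans hi hn
    exact_mod_cast this
  simp only [Set.mem_prod, Set.mem_Iic, Set.mem_univ, and_true]
  lia

/-- The essential spectrum of `(c - □)⁻¹` is `{0, 1/c}`, because the kernel of `□` is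
infinite-dimensional. -/
theorem exists_finset_resolventMul_le {c ρ : ℝ} (hρ : 0 < ρ) (hρc : 1 / c ≤ ρ) :
    ∃ J : Finset NonzeroIndex, ∀ i ∉ J, resolventMul c i ≤ ρ := by
  refine ⟨(finite_setOf_freq_le (|c| + 1 / ρ)).toFinset, fun i hi => ?_⟩
  rw [Set.Finite.mem_toFinset, Set.mem_ofPred_eq, not_le] at hi
  by_cases hdiag : freqS i.1 = freqT i.1
  · rw [resolventMul, modeEig, hdiag, sub_self, sub_zero, ← one_div]
    exact hρc
  · have hfar : 1 / ρ ≤ |c - modeEig i| := by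
      have := abs_sub_abs_le_abs_sub (modeEig i) c
      rw [abs_sub_comm] at this
      linarith [add_freq_le_abs_modeEig hdiag]
    calc resolventMul c i ≤ |c - modeEig i|⁻¹ := by
          rw [resolventMul, ← abs_inv]; exact le_abs_self _
      _ ≤ (1 / ρ)⁻¹ := inv_anti₀ (by positivity) hfar
      _ = ρ := by rw [one_div, inv_inv]

namespace InGap

variable {k : ℤ} {c c' : ℝ}

lemma min_pos (hc : InGap k c) : 0 < min (c - eig k) (eig (k + 1) - c) :=
  lt_min (sub_pos.2 hc.1) (sub_pos.2 hc.2)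

lemma gapBound_nonneg (hc : InGap k c) : 0 ≤ gapBound k c :=
  one_div_nonneg.2 hc.min_pos.le

lemma ne_modeEig (hc : InGap k c) (i : ModeIndex) : c ≠ modeEig i :=
  sub_ne_zero.1 <| abs_pos.1 <| hc.min_pos.trans_le <| min_sub_eig_le_abs_sub_modeEig k c i

lemma abs_resolventMul_le (hc : InGap k c) (i : NonzeroIndex) :
    |resolventMul c i| ≤ gapBound k c := by
  rw [resolventMul, abs_inv, gapBound, one_div]
  exact inv_anti₀ hc.min_pos (min_sub_eig_le_abs_sub_modeEig k c i)

lemma resolventMul_le (hc : InGap k c) (i : NonzeroIndex) :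
    resolventMul c i ≤ 1 / (c - eig k) := by
  have hpos : 0 < c - eig k := sub_pos.2 hc.1
  rw [resolventMul, one_div]
  rcases modeEig_le_eig_or_eig_succ_le k i with h | h
  · exact inv_anti₀ hpos (sub_le_sub_left h c)
  · exact (inv_nonpos.2 (by linarith [hc.2])).trans (inv_nonneg.2 hpos.le)

lemma resolventMul_sub_resolventMul (hc : InGap k c) (hc' : InGap k c') (i : NonzeroIndex) :
    resolventMul c' i - resolventMul c i = (c - c') * (resolventMul c' i * resolventMul c i) := by
  rw [resolventMul, resolventMul,
    inv_sub_inv (sub_ne_zero.2 (hc'.ne_modeEig i)) (sub_ne_zero.2 (hc.ne_modeEig i)),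
    sub_sub_sub_cancel_right, div_eq_mul_inv, mul_inv]

lemma abs_resolventMul_sub_le (hc : InGap k c) (hc' : InGap k c') (i : NonzeroIndex) :
    |resolventMul c' i - resolventMul c i| ≤ |c - c'| * (gapBound k c' * gapBound k c) := by
  rw [hc.resolventMul_sub_resolventMul hc', abs_mul, abs_mul]
  exact mul_le_mul_of_nonneg_left (mul_le_mul (hc'.abs_resolventMul_le i)
    (hc.abs_resolventMul_le i) (abs_nonneg _) hc'.gapBound_nonneg) (abs_nonneg _)

lemma diagOp_resolventMul_add_smul (hc : InGap k c) (hc' : InGap k c') (v : L2Strip) :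
    diagOp unitMode (resolventMul c)
        (v + (c - c') • diagOp unitMode (resolventMul c') v) =
      diagOp unitMode (resolventMul c') v := by
  refine (hasSum_diagOp orthonormal_unitMode hc.abs_resolventMul_le _).unique <|
    (hasSum_diagOp orthonormal_unitMode hc'.abs_resolventMul_le v).congr_fun fun i => ?_
  congr 1
  rw [inner_add_right, inner_smul_right,
    inner_diagOp orthonormal_unitMode hc'.abs_resolventMul_le]
  linear_combination
    -(inner ℝ (unitMode i) v) * hc.resolventMul_sub_resolventMul hc' i

end InGap

end SpectralGap

section FucikForm

variable {k : ℤ} {a b c c' : ℝ}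

/-- The functional dual to `½ (⟨□u, u⟩ - a ‖u⁺‖² - b ‖u⁻‖²)` after the shift by `c`,
`½ (‖v⁺‖²/(c - a) + ‖v⁻‖²/(c - b) - ⟨(c - □)⁻¹ v, v⟩)`. -/
noncomputable def fucikForm (c a b : ℝ) (v : L2Strip) : ℝ :=
  jumpEnergy (1 / (c - a)) (1 / (c - b)) v - inner ℝ (diagOp unitMode (resolventMul c) v) v / 2

/-- `fucikForm` is positive definite, which characterizes the points `(a, b)` above `𝒟_k`. -/
def FucikPosDef (c a b : ℝ) : Prop := ∃ δ : ℝ, 0 < δ ∧ ∀ v, δ * ‖v‖ ^ 2 ≤ fucikForm c a b v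

/-- The triples `(c, a, b)` with `c` in the spectral gap above `λ_k` and `a, b < c`. -/
def fucikDomain (k : ℤ) : Set (ℝ × ℝ × ℝ) :=
  {q | InGap k q.1 ∧ q.2.1 < q.1 ∧ q.2.2 < q.1}

/-- The triples at which `fucikForm` is positive definite. -/
def fucikPosDefSet (k : ℤ) : Set (ℝ × ℝ × ℝ) :=
  {q ∈ fucikDomain k | FucikPosDef q.1 q.2.1 q.2.2}

/-- The triples at which `fucikForm` takes a negative value. -/
def fucikNegSet (k : ℤ) : Set (ℝ × ℝ × ℝ) :=
  {q ∈ fucikDomain k | ∃ v, fucikForm q.1 q.2.1 q.2.2 v < 0}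

lemma isOpen_fucikDomain (k : ℤ) : IsOpen (fucikDomain k) := by
  simp only [fucikDomain, InGap, Set.ofPred_and]
  refine ((isOpen_lt ?_ ?_).inter (isOpen_lt ?_ ?_)).inter
    ((isOpen_lt ?_ ?_).inter (isOpen_lt ?_ ?_)) <;> fun_prop

lemma eventually_abs_one_div_sub_le {X : Type*} [TopologicalSpace X] {f : X → ℝ} {x : X}
    (hf : ContinuousAt f x) (h0 : f x ≠ 0) {ε : ℝ} (hε : 0 < ε) :
    ∀ᶠ y in 𝓝 x, |1 / f y - 1 / f x| ≤ ε := by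
  have hcont : ContinuousAt (fun y => 1 / f y) x := by fun_prop (disch := assumption)
  simpa only [Real.dist_eq] using hcont.eventually (Metric.closedBall_mem_nhds _ hε)

lemma eventually_abs_resolventMul_sub_le (hc : InGap k c) {ε : ℝ} (hε : 0 < ε) :
    ∀ᶠ c' in 𝓝 c, ∀ i, |resolventMul c' i - resolventMul c i| ≤ ε := by
  have hcont : ContinuousAt (fun c' => |c - c'| * (gapBound k c' * gapBound k c)) c := by
    have := hc.min_pos.ne'
    unfold gapBound
    fun_prop (disch := assumption)
  have hlim : Tendsto (fun c' => |c - c'| * (gapBound k c' * gapBound k c)) (𝓝 c) (𝓝 0) := by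
    simpa using hcont.tendsto
  filter_upwards [hlim.eventually (gt_mem_nhds hε), Ioo_mem_nhds hc.1 hc.2] with c' hsmall hc' i
  exact (hc.abs_resolventMul_sub_le hc' i).trans hsmall.le

lemma eventually_abs_fucikForm_sub_le {q : ℝ × ℝ × ℝ} (hq : q ∈ fucikDomain k) {ε : ℝ}
    (hε : 0 < ε) : ∀ᶠ q' in 𝓝 q, ∀ v,
      |fucikForm q'.1 q'.2.1 q'.2.2 v - fucikForm q.1 q.2.1 q.2.2 v| ≤ ε * ‖v‖ ^ 2 := by
  have ⟨hc, ha, hb⟩ := hq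
  filter_upwards [(isOpen_fucikDomain k).mem_nhds hq,
    continuousAt_fst.eventually (eventually_abs_resolventMul_sub_le hc hε),
    eventually_abs_one_div_sub_le (f := fun q : ℝ × ℝ × ℝ => q.1 - q.2.1) (by fun_prop)
      (sub_pos.2 ha).ne' hε,
    eventually_abs_one_div_sub_le (f := fun q : ℝ × ℝ × ℝ => q.1 - q.2.2) (by fun_prop)
      (sub_pos.2 hb).ne' hε] with q' hq' hres hα hβ v
  have hform := abs_inner_diagOp_self_sub_le orthonormal_unitMode hq'.1.abs_resolventMul_le
    hc.abs_resolventMul_le hε.le hres v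
  have henergy := abs_jumpEnergy_sub_le hα hβ v
  rw [abs_le] at hform henergy ⊢
  simp only [fucikForm]
  constructor <;> linarith

lemma isOpen_fucikPosDefSet (k : ℤ) : IsOpen (fucikPosDefSet k) := by
  rw [isOpen_iff_mem_nhds]
  rintro q ⟨hq, δ, hδ, h⟩
  filter_upwards [(isOpen_fucikDomain k).mem_nhds hq,
    eventually_abs_fucikForm_sub_le hq (half_pos hδ)] with q' hq' hclose
  exact ⟨hq', δ / 2, half_pos hδ, fun v => by linarith [h v, (abs_le.1 (hclose v)).1]⟩

lemma isOpen_fucikNegSet (k : ℤ) : IsOpen (fucikNegSet k) := by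
  rw [isOpen_iff_mem_nhds]
  rintro q ⟨hq, v, hv⟩
  set ε := -fucikForm q.1 q.2.1 q.2.2 v / (2 * (‖v‖ ^ 2 + 1)) with hε
  have hpos : 0 < ε := div_pos (neg_pos.2 hv) (by positivity)
  have hhalf : ε * (‖v‖ ^ 2 + 1) = -fucikForm q.1 q.2.1 q.2.2 v / 2 := by
    rw [hε]; field_simp
  filter_upwards [(isOpen_fucikDomain k).mem_nhds hq,
    eventually_abs_fucikForm_sub_le hq hpos] with q' hq' hclose
  exact ⟨hq', v, by linarith [(abs_le.1 (hclose v)).2]⟩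

lemma disjoint_fucikPosDefSet_fucikNegSet (k : ℤ) :
    Disjoint (fucikPosDefSet k) (fucikNegSet k) := by
  rw [Set.disjoint_left]
  rintro q ⟨-, δ, hδ, h⟩ ⟨-, v, hv⟩
  have : 0 ≤ δ * ‖v‖ ^ 2 := by positivity
  linarith [h v]

lemma fucikPosDef_of_eig_lt (hc : InGap k c) (ha : a ∈ Set.Ioo (eig k) c)
    (hb : b ∈ Set.Ioo (eig k) c) : FucikPosDef c a b := by
  have hlt : 1 / (c - eig k) < min (1 / (c - a)) (1 / (c - b)) :=
    lt_min (one_div_lt_one_div_of_lt (sub_pos.2 ha.2) (by linarith [ha.1]))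
      (one_div_lt_one_div_of_lt (sub_pos.2 hb.2) (by linarith [hb.1]))
  refine ⟨_, half_pos (sub_pos.2 hlt), fun v => ?_⟩
  have hform := inner_diagOp_self_le orthonormal_unitMode hc.abs_resolventMul_le
    (one_div_nonneg.2 (sub_pos.2 hc.1).le) (J := ∅) (fun i _ => hc.resolventMul_le i) v
  rw [Finset.sum_empty, mul_zero, add_zero] at hform
  have henergy := mul_norm_sq_le_jumpEnergy (min_le_left (1 / (c - a)) (1 / (c - b)))
    (min_le_right _ _) v
  rw [fucikForm]
  linarith

lemma fucikForm_smul (c a b : ℝ) {t : ℝ} (ht : 0 ≤ t) (v : L2Strip) :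
    fucikForm c a b (t • v) = t ^ 2 * fucikForm c a b v := by
  rw [fucikForm, fucikForm, jumpEnergy_smul _ _ ht, diagOp_smul, inner_smul_left, inner_smul_right]
  simp only [conj_trivial]
  ring

lemma fucikForm_eq_zero_of_jumpOp_eq {v : L2Strip}
    (h : jumpOp (1 / (c - a)) (1 / (c - b)) v = diagOp unitMode (resolventMul c) v) :
    fucikForm c a b v = 0 := by
  rw [fucikForm, ← h, inner_jumpOp_self]
  ring

/-- A semidefinite form that is not definite has a nontrivial zero, which minimizes it. -/
theorem exists_jumpOp_eq_diagOp (hc : InGap k c)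
    (hess : max 0 (1 / c) < min (1 / (c - a)) (1 / (c - b)))
    (hdegenerate : ¬ FucikPosDef c a b) (hnonneg : ∀ v, 0 ≤ fucikForm c a b v) :
    ∃ v ≠ 0, jumpOp (1 / (c - a)) (1 / (c - b)) v = diagOp unitMode (resolventMul c) v := by
  obtain ⟨ρ, hlow, hhigh⟩ := exists_between hess
  have hρ : 0 < ρ := (le_max_left _ _).trans_lt hlow
  obtain ⟨J, hJ⟩ := exists_finset_resolventMul_le hρ ((le_max_right 0 (1 / c)).trans hlow.le)
  have hbounds := hasQuadraticBounds_jumpEnergy (μ := stripMeasure) (1 / (c - a)) (1 / (c - b))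
  have hconvex := hbounds.stronglyConvexModulo_sub_diagOp orthonormal_unitMode
    hc.abs_resolventMul_le hc.gapBound_nonneg hρ.le hJ
  obtain ⟨v, hv, hgrad⟩ := hconvex.exists_ne_zero_gradient_eq_zero
    (half_pos (sub_pos.2 hhigh))
    (hbounds.sub_diagOp_le orthonormal_unitMode hc.abs_resolventMul_le hc.gapBound_nonneg)
    (fun t ht v => fucikForm_smul c a b ht v) hnonneg fun δ hδ => by
      by_contra! hδ'
      exact hdegenerate ⟨δ, hδ, hδ'⟩
  exact ⟨v, hv, sub_eq_zero.1 hgrad⟩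

/-- Both sides say that `u = (c - □)⁻¹ v` solves `□u = a u⁺ - b u⁻`, an equation that does not
involve the shift `c`. -/
theorem exists_jumpOp_eq_diagOp_of_shift (hc : InGap k c) (ha : a < c) (hb : b < c)
    (hc' : InGap k c') (ha' : a < c') (hb' : b < c')
    (h : ∃ v ≠ 0, jumpOp (1 / (c' - a)) (1 / (c' - b)) v = diagOp unitMode (resolventMul c') v) :
    ∃ v ≠ 0, jumpOp (1 / (c - a)) (1 / (c - b)) v = diagOp unitMode (resolventMul c) v := by
  obtain ⟨v, hv, hres⟩ := h
  set u := diagOp unitMode (resolventMul c') v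
  rw [← sub_pos] at ha hb ha' hb'
  have hvu : jumpOp (c' - a) (c' - b) u = v := by
    rw [← hres, jumpOp_jumpOp (by positivity) (by positivity), mul_one_div_cancel ha'.ne',
      mul_one_div_cancel hb'.ne', jumpOp_one_one]
  have hu : u ≠ 0 := by
    intro hu
    rw [hu, jumpOp_zero] at hvu
    exact hv hvu.symm
  have hshift : v + (c - c') • u = jumpOp (c - a) (c - b) u := by
    nth_rw 1 [← hvu]
    rw [jumpOp_add_smul]
    congr 1 <;> ring
  have hinv : jumpOp (1 / (c - a)) (1 / (c - b)) (v + (c - c') • u) = u := by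
    rw [hshift, jumpOp_jumpOp ha.le hb.le, one_div_mul_cancel ha.ne', one_div_mul_cancel hb.ne',
      jumpOp_one_one]
  refine ⟨v + (c - c') • u, fun hzero => hu ?_, ?_⟩
  · rw [← hinv, hzero, jumpOp_zero]
  · rw [hinv, hc.diagOp_resolventMul_add_smul hc']

theorem FucikPosDef.mono (h : FucikPosDef c a b) (hc : InGap k c) (ha : a < c) (hb : b < c)
    (hcc' : c ≤ c') (hc' : InGap k c')
    (hess : ∀ x ∈ Set.Icc c c', max 0 (1 / x) < min (1 / (x - a)) (1 / (x - b))) :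
    FucikPosDef c' a b := by
  have hcont : Continuous fun x : ℝ => (x, a, b) := by fun_prop
  have hdom : ∀ x ∈ Set.Icc c c', (x, a, b) ∈ fucikDomain k := fun x hx =>
    ⟨⟨hc.1.trans_le hx.1, hx.2.trans_lt hc'.2⟩, ha.trans_le hx.1, hb.trans_le hx.1⟩
  suffices hcover : Set.Icc c c' ⊆ (fun x : ℝ => (x, a, b)) ⁻¹' fucikPosDefSet k ∪
      (fun x : ℝ => (x, a, b)) ⁻¹' fucikNegSet k from
    (isPreconnected_Icc.subset_left_of_subset_union ((isOpen_fucikPosDefSet k).preimage hcont)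
      ((isOpen_fucikNegSet k).preimage hcont)
      ((disjoint_fucikPosDefSet_fucikNegSet k).preimage _) hcover
      ⟨c, Set.left_mem_Icc.2 hcc', hdom c (Set.left_mem_Icc.2 hcc'), h⟩
      (Set.right_mem_Icc.2 hcc')).2
  intro x hx
  by_contra hneither
  rw [Set.mem_union, not_or] at hneither
  have hresonant := exists_jumpOp_eq_diagOp (hdom x hx).1 (hess x hx)
    (fun hpos => hneither.1 ⟨hdom x hx, hpos⟩)
    fun v => not_lt.1 fun hv => hneither.2 ⟨hdom x hx, v, hv⟩
  obtain ⟨v, hv, hres⟩ := exists_jumpOp_eq_diagOp_of_shift hc ha hb (hdom x hx).1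
    (hdom x hx).2.1 (hdom x hx).2.2 hresonant
  obtain ⟨δ, hδ, hpos⟩ := h
  have hzero := hpos v
  rw [fucikForm_eq_zero_of_jumpOp_eq hres] at hzero
  have : 0 < ‖v‖ := norm_pos_iff.2 hv
  exact hzero.not_gt (by positivity)

end FucikForm

section AboveCurve

variable {k : ℤ} {a b c ε₃ ε₄ : ℝ}

lemma iSup_div_eq_of_degenerate {E : Type*} [NormedAddCommGroup E] {num den : E → ℝ} {α m : ℝ}
    (hm : 0 < m) (hden : ∀ v, m * ‖v‖ ^ 2 ≤ den v) (hle : ∀ v, num v ≤ α * den v)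
    (hdegenerate : ∀ δ > 0, ∃ v, α * den v - num v < δ * ‖v‖ ^ 2) :
    ⨆ v : {v : E // v ≠ 0}, num v / den v = α := by
  have hden_pos : ∀ v, v ≠ 0 → 0 < den v := fun v hv =>
    lt_of_lt_of_le (mul_pos hm (pow_pos (norm_pos_iff.2 hv) 2)) (hden v)
  have hne : ∀ {δ : ℝ} {v : E}, α * den v - num v < δ * ‖v‖ ^ 2 → v ≠ 0 := by
    rintro δ _ hlt rfl
    rw [norm_zero, zero_pow two_ne_zero, mul_zero] at hlt
    linarith [hle 0]
  have : Nonempty {v : E // v ≠ 0} :=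
    let ⟨v, hv⟩ := hdegenerate 1 one_pos
    ⟨v, hne hv⟩
  refine ciSup_eq_of_forall_le_of_forall_lt_exists_gt
    (fun v => (div_le_iff₀ (hden_pos v v.2)).2 (hle v)) fun w hw => ?_
  obtain ⟨v, hv⟩ := hdegenerate ((α - w) * m) (mul_pos (sub_pos.2 hw) hm)
  refine ⟨⟨v, hne hv⟩, (lt_div_iff₀ (hden_pos v (hne hv))).2 ?_⟩
  linarith [mul_le_mul_of_nonneg_left (hden v) (sub_pos.2 hw).le]

lemma two_mul_fucikForm (hc : InGap k c) (a b ρ : ℝ) (v : L2Strip) :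
    2 * fucikForm c a b v = (1 / (c - a) - ρ) * ‖Lp.posPart v‖ ^ 2
      + (1 / (c - b) - ρ) * ‖Lp.negPart v‖ ^ 2 - inner ℝ (resolventOp c v - ρ • v) v := by
  rw [fucikForm, jumpEnergy, resolventOp_eq_diagOp hc.abs_resolventMul_le, inner_sub_left,
    real_inner_smul_left, real_inner_self_eq_norm_sq, ← norm_posPart_sq_add_norm_negPart_sq v]
  ring

lemma Admissible.inGap (h : Admissible k ε₃ ε₄) : InGap k (eig (k + 1) - ε₃) :=
  ⟨by linarith [h.1.2], by linarith [h.1.1]⟩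

lemma Admissible.rho_pos (h : Admissible k ε₃ ε₄) : 0 < rho k ε₃ ε₄ :=
  add_pos_of_nonneg_of_pos (le_max_left _ _) h.2.1

lemma Admissible.rho_lt_one_div_of_mem_squareR (h : Admissible k ε₃ ε₄)
    (hab : (a, b) ∈ squareR k ε₃ ε₄) :
    rho k ε₃ ε₄ < 1 / (eig (k + 1) - ε₃ - a) ∧ rho k ε₃ ε₄ < 1 / (eig (k + 1) - ε₃ - b) := by
  have hlt : ∀ {x : ℝ}, 0 < x → x < 1 / rho k ε₃ ε₄ → rho k ε₃ ε₄ < 1 / x := fun hx hρ =>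
    (lt_one_div hx h.rho_pos).1 hρ
  obtain ⟨⟨ha, ha'⟩, hb, hb'⟩ := hab
  exact ⟨hlt (sub_pos.2 ha') (sub_lt_comm.1 ha), hlt (sub_pos.2 hb') (sub_lt_comm.1 hb)⟩

lemma aTilde_eq_of_degenerate (hc : InGap k (eig (k + 1) - ε₃))
    (hρa : rho k ε₃ ε₄ < 1 / (eig (k + 1) - ε₃ - a))
    (hρb : rho k ε₃ ε₄ < 1 / (eig (k + 1) - ε₃ - b))
    (hdegenerate : ¬ FucikPosDef (eig (k + 1) - ε₃) a b)
    (hnonneg : ∀ v, 0 ≤ fucikForm (eig (k + 1) - ε₃) a b v) :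
    aTilde k ε₃ ε₄ ((1 / (eig (k + 1) - ε₃ - b) - rho k ε₃ ε₄) /
      (1 / (eig (k + 1) - ε₃ - a) - rho k ε₃ ε₄)) =
      1 / (eig (k + 1) - ε₃ - a) - rho k ε₃ ε₄ := by
  have hform := two_mul_fucikForm hc a b (rho k ε₃ ε₄)
  rw [← sub_pos] at hρa hρb
  set c := eig (k + 1) - ε₃
  set α := 1 / (c - a) - rho k ε₃ ε₄
  set β := 1 / (c - b) - rho k ε₃ ε₄
  have hβ : α * (β / α) = β := mul_div_cancel₀ β hρa.ne'
  have hr : 0 < β / α := by positivity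
  refine iSup_div_eq_of_degenerate
    (num := fun v : L2Strip => inner ℝ (resolventOp c v - rho k ε₃ ε₄ • v) v)
    (den := fun v : L2Strip => ‖Lp.posPart v‖ ^ 2 + β / α * ‖Lp.negPart v‖ ^ 2)
    (lt_min one_pos hr) (fun v => ?_) (fun v => ?_) fun δ hδ => ?_
  · have := mul_norm_sq_le_jumpEnergy (min_le_left 1 (β / α)) (min_le_right 1 (β / α)) v
    rw [jumpEnergy] at this
    linarith
  · rw [mul_add, ← mul_assoc, hβ]
    linarith [hform v, hnonneg v]
  · by_contra! hle
    refine hdegenerate ⟨δ / 2, half_pos hδ, fun v => ?_⟩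
    have := hle v
    rw [mul_add, ← mul_assoc, hβ] at this
    linarith [hform v]

theorem mem_curveD (hadm : Admissible k ε₃ ε₄) (hab : (a, b) ∈ squareR k ε₃ ε₄)
    (hdegenerate : ¬ FucikPosDef (eig (k + 1) - ε₃) a b)
    (hnonneg : ∀ v, 0 ≤ fucikForm (eig (k + 1) - ε₃) a b v) : (a, b) ∈ curveD k ε₃ ε₄ := by
  obtain ⟨hρa, hρb⟩ := hadm.rho_lt_one_div_of_mem_squareR hab
  have haTilde := aTilde_eq_of_degenerate hadm.inGap hρa hρb hdegenerate hnonneg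
  rw [← sub_pos] at hρa hρb
  refine ⟨_, div_pos hρb hρa, ?_⟩
  rw [haTilde, div_mul_cancel₀ _ hρa.ne', sub_add_cancel, sub_add_cancel, one_div_one_div,
    one_div_one_div, sub_sub_cancel, sub_sub_cancel]

theorem fucikPosDef_of_mem_aboveInSquare {z : ℝ × ℝ} (hadm : Admissible k ε₃ ε₄)
    (hz : z ∈ aboveInSquare k ε₃ ε₄) :
    z ∈ squareR k ε₃ ε₄ ∧ FucikPosDef (eig (k + 1) - ε₃) z.1 z.2 := by
  obtain ⟨z₀, hz₀, hz⟩ := hz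
  have hsub := connectedComponentIn_subset (squareR k ε₃ ε₄ \ curveD k ε₃ ε₄) z₀
  have hz₀' : z₀ ∈ squareR k ε₃ ε₄ \ curveD k ε₃ ε₄ :=
    connectedComponentIn_nonempty_iff.1 ⟨z, hz⟩
  have hcont : Continuous fun z : ℝ × ℝ => (eig (k + 1) - ε₃, z) := by fun_prop
  have hdom : ∀ y ∈ squareR k ε₃ ε₄, (eig (k + 1) - ε₃, y) ∈ fucikDomain k := fun y hy =>
    ⟨hadm.inGap, hy.1.2, hy.2.2⟩
  suffices hcover : connectedComponentIn (squareR k ε₃ ε₄ \ curveD k ε₃ ε₄) z₀ ⊆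
      (fun z : ℝ × ℝ => (eig (k + 1) - ε₃, z)) ⁻¹' fucikPosDefSet k ∪
      (fun z : ℝ × ℝ => (eig (k + 1) - ε₃, z)) ⁻¹' fucikNegSet k from
    ⟨(hsub hz).1, (isPreconnected_connectedComponentIn.subset_left_of_subset_union
      ((isOpen_fucikPosDefSet k).preimage hcont) ((isOpen_fucikNegSet k).preimage hcont)
      ((disjoint_fucikPosDefSet_fucikNegSet k).preimage _) hcover
      ⟨z₀, mem_connectedComponentIn hz₀', hdom z₀ hz₀'.1,
        fucikPosDef_of_eig_lt hadm.inGap hz₀.1 hz₀.2⟩ hz).2⟩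
  intro y hy
  obtain ⟨hyR, hyD⟩ := hsub hy
  by_contra hneither
  rw [Set.mem_union, not_or] at hneither
  exact hyD <| mem_curveD hadm hyR (fun hpos => hneither.1 ⟨hdom y hyR, hpos⟩) fun v =>
    not_lt.1 fun hv => hneither.2 ⟨hdom y hyR, v, hv⟩

lemma max_lt_min_of_mem_squareRTilde (hab : (a, b) ∈ squareRTilde k) (hc : InGap k c)
    (ha : a < c) (hb : b < c) : max 0 (1 / c) < min (1 / (c - a)) (1 / (c - b)) := by
  rw [← sub_pos] at ha hb
  refine max_lt (lt_min (by positivity) (by positivity)) ?_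
  rcases hab with ⟨hk, -, -⟩ | ⟨-, ha', hb'⟩
  · have hneg : 1 / c < 0 := one_div_neg.2 (hc.2.trans_le (eig_succ_nonpos hk))
    exact lt_min (hneg.trans (by positivity)) (hneg.trans (by positivity))
  · exact lt_min (one_div_lt_one_div_of_lt ha (by linarith [ha'.1]))
      (one_div_lt_one_div_of_lt hb (by linarith [hb'.1]))

end AboveCurve

section Energy

variable {a b σ L : ℝ} {p : Strip → ℝ → ℝ}

lemma continuous_nonlinearity (a b : ℝ) (hp : Continuous (Function.uncurry p)) :
    Continuous (Function.uncurry (nonlinearity a b p)) := by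
  unfold nonlinearity
  fun_prop

lemma primitive_nonlinearity (a b : ℝ) (hp : Continuous (Function.uncurry p)) (z : Strip)
    (x : ℝ) : primitive (nonlinearity a b p) z x =
      primitive (fun _ => jump a b) z x + primitive p z x :=
  intervalIntegral.integral_add ((slopeBounds_jump a b).intervalIntegrable _ _)
    ((hp.uncurry_left z).intervalIntegrable _ _)

lemma energy_eq (hp : Continuous (Function.uncurry p))
    (hs : ∀ z, SlopeBounds (nonlinearity a b p z) σ L) (w : sobolevSpace × kernelSpace) :
    energy a b p w = 1 / 2 * (‖(w.1 : L2Strip × L2Strip × L2Strip).2.1‖ ^ 2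
      - ‖(w.1 : L2Strip × L2Strip × L2Strip).2.2‖ ^ 2)
      - ∫ z, primitive (nonlinearity a b p) z (toFunction w z) ∂stripMeasure := by
  have hsplit : ∫ z, primitive p z (toFunction w z) ∂stripMeasure =
      ∫ z, primitive (nonlinearity a b p) z (toFunction w z) ∂stripMeasure
        - jumpEnergy a b (toFunction w) := by
    rw [← integral_primitive_jump, ← integral_sub
      (integrable_primitive (continuous_nonlinearity a b hp) hs _)
      (integrable_primitive_jump a b _)]
    simp only [primitive_nonlinearity a b hp, add_sub_cancel_left]
  rw [jumpEnergy] at hsplit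
  simp only [primitive] at hsplit ⊢
  rw [energy, hsplit]
  ring

/-- The weak derivative `(x, y) ↦ x_s` on `ℋ¹ × 𝒩`. -/
noncomputable def weakDerivS : sobolevSpace × kernelSpace →L[ℝ] L2Strip :=
  .fst ℝ L2Strip L2Strip ∘L .snd ℝ L2Strip (L2Strip × L2Strip) ∘L sobolevSpace.subtypeL ∘L
    .fst ℝ sobolevSpace kernelSpace

/-- The weak derivative `(x, y) ↦ x_t` on `ℋ¹ × 𝒩`. -/
noncomputable def weakDerivT : sobolevSpace × kernelSpace →L[ℝ] L2Strip :=
  .snd ℝ L2Strip L2Strip ∘L .snd ℝ L2Strip (L2Strip × L2Strip) ∘L sobolevSpace.subtypeL ∘L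
    .fst ℝ sobolevSpace kernelSpace

/-- The map `toFunction` as a continuous linear map. -/
noncomputable def toFunctionL : sobolevSpace × kernelSpace →L[ℝ] L2Strip :=
  .fst ℝ L2Strip (L2Strip × L2Strip) ∘L sobolevSpace.subtypeL ∘L .fst ℝ sobolevSpace kernelSpace
    + kernelSpace.subtypeL ∘L .snd ℝ sobolevSpace kernelSpace

lemma hasFDerivAt_energy (hp : Continuous (Function.uncurry p))
    (hs : ∀ z, SlopeBounds (nonlinearity a b p z) σ L) (w : sobolevSpace × kernelSpace) :
    HasFDerivAt (energy a b p)
      (innerSL ℝ (weakDerivS w) ∘L weakDerivS - innerSL ℝ (weakDerivT w) ∘L weakDerivT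
        - innerSL ℝ (superpose (continuous_nonlinearity a b hp) hs (toFunction w)) ∘L toFunctionL)
      w := by
  have hprimitive := (hasQuadraticBounds_superpose (μ := stripMeasure)
    (continuous_nonlinearity a b hp) hs).hasFDerivAt (toFunctionL w)
  have hsq := (weakDerivS.hasFDerivAt (x := w)).norm_sq.sub
    (weakDerivT.hasFDerivAt (x := w)).norm_sq
  refine (((hsq.const_mul (1 / 2)).sub
    (hprimitive.comp w toFunctionL.hasFDerivAt)).congr_fderiv ?_).congr_of_eventuallyEq
    (.of_forall (energy_eq hp hs))
  refine ContinuousLinearMap.ext fun d => ?_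
  simp only [_root_.sub_apply, _root_.smul_apply, nsmul_eq_mul,
    smul_eq_mul, ContinuousLinearMap.comp_apply, innerSL_apply_apply, Nat.cast_ofNat, ← mul_sub]
  rw [one_div, inv_mul_cancel_left₀ two_ne_zero]
  rfl

theorem isWeakSolution_of_inner_eq (hp : Continuous (Function.uncurry p))
    (hs : ∀ z, SlopeBounds (nonlinearity a b p z) σ L) {w : sobolevSpace × kernelSpace}
    (hw : ∀ d : sobolevSpace × kernelSpace,
        inner ℝ (w.1 : L2Strip × L2Strip × L2Strip).2.1 (d.1 : L2Strip × L2Strip × L2Strip).2.1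
          - inner ℝ (w.1 : L2Strip × L2Strip × L2Strip).2.2
              (d.1 : L2Strip × L2Strip × L2Strip).2.2 =
        inner ℝ (superpose (continuous_nonlinearity a b hp) hs (toFunction w)) (toFunction d)) :
    IsWeakSolution a b p w :=
  (hasFDerivAt_energy hp hs w).congr_fderiv <|
    ContinuousLinearMap.ext fun d => sub_eq_zero.2 (hw d)

end Energy

section DualNonlinearity

variable {a b c σ L η : ℝ} {p : Strip → ℝ → ℝ}

lemma SublinearAtInfinity.exists_abs_le (h : SublinearAtInfinity p)
    (hp : Continuous (Function.uncurry p)) (hη : 0 < η) :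
    ∃ C, ∀ z x, |p z x| ≤ η * |x| + C := by
  have hlim := Metric.tendstoUniformly_iff.1 h η hη
  rw [← Metric.cobounded_eq_cocompact, (hasBasis_cobounded_norm (E := ℝ)).eventually_iff] at hlim
  obtain ⟨R, -, hR⟩ := hlim
  obtain ⟨C, hC₀, hC⟩ := exists_abs_le_of_abs_le hp (max R 1)
  refine ⟨C, fun z x => ?_⟩
  rcases le_or_gt |x| (max R 1) with hx | hx
  · linarith [hC z x hx, mul_nonneg hη.le (abs_nonneg x)]
  · have hquot := hR (show R ≤ ‖x‖ from (le_max_left R 1).trans hx.le) z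
    rw [dist_zero_left, norm_div, Real.norm_eq_abs, Real.norm_eq_abs,
      div_lt_iff₀ (one_pos.trans ((le_max_right R 1).trans_lt hx))] at hquot
    linarith

lemma SublinearAtInfinity.exists_abs_primitive_le (h : SublinearAtInfinity p)
    (hp : Continuous (Function.uncurry p)) (hη : 0 < η) :
    ∃ C, ∀ z x, |primitive p z x| ≤ η * x ^ 2 + C := by
  obtain ⟨C, hC⟩ := h.exists_abs_le hp (half_pos hη)
  refine ⟨1 / η / 2 * C ^ 2, fun z x => ?_⟩
  have hyoung := mul_le_weighted_sq_add_sq hη |x| C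
  rw [sq_abs] at hyoung
  linarith [abs_primitive_le_of_abs_le (half_pos hη).le (hC z) x]

/-- The shifted nonlinearity `c u - (a u⁺ - b u⁻ + p(s,t,u))`: the equation reads
`c u - □u = dualNonlinearity c a b p (s,t) u`. -/
noncomputable def dualNonlinearity (c a b : ℝ) (p : Strip → ℝ → ℝ) (z : Strip) (x : ℝ) : ℝ :=
  c * x - nonlinearity a b p z x

lemma continuous_dualNonlinearity (c a b : ℝ) (hp : Continuous (Function.uncurry p)) :
    Continuous (Function.uncurry (dualNonlinearity c a b p)) :=
  (continuous_snd.const_mul c).sub (continuous_nonlinearity a b hp)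

lemma dualNonlinearity_eq (c a b : ℝ) (p : Strip → ℝ → ℝ) (z : Strip) (x : ℝ) :
    dualNonlinearity c a b p z x = jump (c - a) (c - b) x - p z x := by
  rw [jump_sub_sub, dualNonlinearity, nonlinearity, jump, sub_add_eq_sub_sub]

lemma primitive_dualNonlinearity (c a b : ℝ) (hp : Continuous (Function.uncurry p)) (z : Strip)
    (x : ℝ) : primitive (dualNonlinearity c a b p) z x =
      primitive (fun _ => jump (c - a) (c - b)) z x - primitive p z x := by
  simp only [primitive, dualNonlinearity_eq]
  exact intervalIntegral.integral_sub ((slopeBounds_jump _ _).intervalIntegrable _ _)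
    ((hp.uncurry_left z).intervalIntegrable _ _)

lemma slopeBounds_nonlinearity {z : Strip} (h : SlopeBounds (dualNonlinearity c a b p z) σ L) :
    SlopeBounds (nonlinearity a b p z) (c - L) (c - σ) := by
  constructor <;> intro x y hxy
  · have := h.2 hxy
    simp only [dualNonlinearity] at this ⊢
    linarith
  · have := h.1 hxy
    simp only [dualNonlinearity] at this ⊢
    linarith

lemma monotone_dualNonlinearity_sub {z : Strip} {μ : ℝ}
    (h : Antitone fun x => nonlinearity a b p z x - μ * x) (hσ : σ ≤ c - μ) :
    Monotone fun x => dualNonlinearity c a b p z x - σ * x := fun x y hxy => by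
  have hanti := h hxy
  simp only [dualNonlinearity] at hanti ⊢
  linarith [mul_le_mul_of_nonneg_right hσ (sub_nonneg.2 hxy)]

lemma antitone_dualNonlinearity_sub {z : Strip} {μ : ℝ}
    (h : Monotone fun x => nonlinearity a b p z x - μ * x) :
    Antitone fun x => dualNonlinearity c a b p z x - (c - μ) * x := fun x y hxy => by
  have hmono := h hxy
  simp only [dualNonlinearity] at hmono ⊢
  linarith

lemma monotone_nonlinearity_sub {z : Strip} {μ : ℝ} (h : Monotone fun x => p z x + μ * x) :
    Monotone fun x => nonlinearity a b p z x - (min a b - μ) * x := fun x y hxy => by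
  have hmono := h hxy
  have hjump := (slopeBounds_jump a b).1 hxy
  simp only [nonlinearity, jump] at hmono hjump ⊢
  linarith

lemma exists_slopeBounds_dualNonlinearity {k : ℤ} {ε : ℝ} (hk : eig k ≠ 0) (hc : InGap k c)
    (hε : 0 < ε) (hcε : eig (k + 1) - ε / 2 ≤ c)
    (h1 : ∀ z, Antitone fun u => nonlinearity a b p z u - (eig (k + 1) - ε) * u)
    (h2 : HypH2' k a b p) (h3 : HypH3' k p) :
    ∃ L, 0 < L ∧ max 0 (1 / c) < 1 / L ∧
      ∀ z, SlopeBounds (dualNonlinearity c a b p z) (ε / 2) L := by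
  suffices ∃ μ, (1 / c < 0 ∨ 0 < μ) ∧
      ∀ z, Monotone fun u => nonlinearity a b p z u - μ * u by
    obtain ⟨μ, hμ, hmono⟩ := this
    have hs : ∀ z, SlopeBounds (dualNonlinearity c a b p z) (ε / 2) (c - μ) := fun z =>
      ⟨monotone_dualNonlinearity_sub (h1 z) (by linarith), antitone_dualNonlinearity_sub (hmono z)⟩
    have hL : 0 < c - μ := (half_pos hε).trans_le
      ((hs (⟨0, le_rfl, pi_pos.le⟩, 0)).le)
    refine ⟨_, hL, max_lt (by positivity) ?_, hs⟩
    rcases hμ with hneg | hpos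
    · exact hneg.trans (by positivity)
    · exact one_div_lt_one_div_of_lt hL (sub_lt_self c hpos)
  rcases hk.lt_or_gt with hk | hk
  · obtain ⟨ε', -, h⟩ := h3 hk
    exact ⟨_, .inl (one_div_neg.2 (hc.2.trans_le (eig_succ_nonpos hk))),
      fun z => monotone_nonlinearity_sub (h z)⟩
  · obtain ⟨ε', hε', h⟩ := h2 hk
    exact ⟨ε', .inr hε', h⟩

lemma exists_integral_primitive_dualNonlinearity_le (hη : 0 < η)
    (hp : Continuous (Function.uncurry p)) (hsub : SublinearAtInfinity p)
    (hs : ∀ z, SlopeBounds (dualNonlinearity c a b p z) σ L) :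
    ∃ C, ∀ u : L2Strip, ∫ z, primitive (dualNonlinearity c a b p) z (u z) ∂stripMeasure ≤
      jumpEnergy (c - a) (c - b) u + (η * ‖u‖ ^ 2 + C) := by
  obtain ⟨C, hC⟩ := hsub.exists_abs_primitive_le hp hη
  refine ⟨∫ _, C ∂stripMeasure, fun u => ?_⟩
  have hjump := integrable_primitive_jump (c - a) (c - b) u
  have hquad : Integrable (fun z => η * u z ^ 2) stripMeasure :=
    (Lp.memLp u).integrable_sq.const_mul η
  have hsum : Integrable (fun z => η * u z ^ 2 + C) stripMeasure := hquad.add (integrable_const C)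
  rw [← integral_primitive_jump, norm_sq_eq_integral, ← integral_const_mul,
    ← integral_add hquad (integrable_const C), ← integral_add hjump hsum]
  refine integral_mono (integrable_primitive (continuous_dualNonlinearity c a b hp) hs u)
    (hjump.add hsum) fun z => ?_
  beta_reduce
  rw [primitive_dualNonlinearity c a b hp]
  linarith [neg_le_of_abs_le (hC z (u z))]

/-- The witness `u = v⁺ / (c - a) - v⁻ / (c - b)` maximizes
`inner ℝ u v - jumpEnergy (c - a) (c - b) u`. -/
lemma exists_jumpEnergy_le_inner_sub (ha : a < c) (hb : b < c) (hη : 0 < η)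
    (hp : Continuous (Function.uncurry p)) (hsub : SublinearAtInfinity p)
    (hs : ∀ z, SlopeBounds (dualNonlinearity c a b p z) σ L) :
    ∃ C, ∀ v : L2Strip, ∃ u : L2Strip,
      jumpEnergy (1 / (c - a)) (1 / (c - b)) v - η * ‖v‖ ^ 2 - C ≤
        inner ℝ u v - ∫ z, primitive (dualNonlinearity c a b p) z (u z) ∂stripMeasure := by
  rw [← sub_pos] at ha hb
  have hm : 0 < min (c - a) (c - b) := lt_min ha hb
  set m := min (c - a) (c - b)
  obtain ⟨C, hC⟩ := exists_integral_primitive_dualNonlinearity_le (η := η * m ^ 2)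
    (by positivity) hp hsub hs
  refine ⟨C, fun v => ?_⟩
  obtain ⟨u, hu⟩ : ∃ u, u = jumpOp (1 / (c - a)) (1 / (c - b)) v := ⟨_, rfl⟩
  have hv : jumpOp (c - a) (c - b) u = v := by
    rw [hu, jumpOp_jumpOp (by positivity) (by positivity), mul_one_div_cancel ha.ne',
      mul_one_div_cancel hb.ne', jumpOp_one_one]
  have huv : inner ℝ u v = 2 * jumpEnergy (1 / (c - a)) (1 / (c - b)) v :=
    hu ▸ inner_jumpOp_self _ _ v
  have hvu : inner ℝ u v = 2 * jumpEnergy (c - a) (c - b) u := by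
    rw [real_inner_comm, ← inner_jumpOp_self, hv]
  have hnorm : (m * ‖u‖) ^ 2 ≤ ‖v‖ ^ 2 := by
    have := mul_norm_le_norm_jumpOp (min_le_left (c - a) (c - b)) (min_le_right _ _) u
    rw [hv] at this
    gcongr
  refine ⟨u, ?_⟩
  linarith [hC u, mul_le_mul_of_nonneg_left hnorm hη.le]

lemma superpose_nonlinearity_eq (hp : Continuous (Function.uncurry p))
    (hs : ∀ z, SlopeBounds (dualNonlinearity c a b p z) σ L) (u : L2Strip) :
    superpose (continuous_nonlinearity a b hp) (fun z => slopeBounds_nonlinearity (hs z)) u =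
      c • u - superpose (continuous_dualNonlinearity c a b hp) hs u := by
  ext
  filter_upwards [coeFn_superpose (continuous_dualNonlinearity c a b hp) hs u,
    coeFn_superpose (continuous_nonlinearity a b hp) (fun z => slopeBounds_nonlinearity (hs z)) u,
    Lp.coeFn_sub (c • u) (superpose (continuous_dualNonlinearity c a b hp) hs u),
    Lp.coeFn_smul c u] with z hdual hprimal hsub hsmul
  rw [hprimal, hsub, Pi.sub_apply, hdual, hsmul, Pi.smul_apply, smul_eq_mul, dualNonlinearity,
    sub_sub_cancel]

theorem exists_isWeakSolution {k : ℤ} {ε : ℝ} (hk : eig k ≠ 0) (hc : InGap k c) (ha : a < c)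
    (hb : b < c) (hpos : FucikPosDef c a b) (hp : Continuous (Function.uncurry p))
    (hsub : SublinearAtInfinity p) (hε : 0 < ε) (hcε : eig (k + 1) - ε / 2 ≤ c)
    (h1 : ∀ z, Antitone fun u => nonlinearity a b p z u - (eig (k + 1) - ε) * u)
    (h2 : HypH2' k a b p) (h3 : HypH3' k p) :
    ∃ w : sobolevSpace × kernelSpace, IsWeakSolution a b p w := by
  obtain ⟨L, hL, hcL, hs⟩ := exists_slopeBounds_dualNonlinearity hk hc hε hcε h1 h2 h3
  obtain ⟨δ, hδ, hform⟩ := hpos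
  obtain ⟨C, hC⟩ := exists_jumpEnergy_le_inner_sub ha hb (half_pos hδ) hp hsub hs
  obtain ⟨ρ, hρc, hρL⟩ := exists_between hcL
  obtain ⟨hρ, hρc⟩ := max_lt_iff.1 hρc
  obtain ⟨J, hJ⟩ := exists_finset_resolventMul_le hρ hρc.le
  obtain ⟨v, hv⟩ := (hasQuadraticBounds_superpose (μ := stripMeasure)
      (continuous_dualNonlinearity c a b hp) hs).exists_gradient_diagOp_eq (C := C)
    orthonormal_unitMode hc.abs_resolventMul_le hc.gapBound_nonneg hρ.le hJ (half_pos hε) hL hρL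
    (half_pos hδ) fun v => by
      obtain ⟨u, hu⟩ := hC v
      have := hform v
      rw [fucikForm] at this
      exact ⟨u, by linarith⟩
  obtain ⟨w, hw, hweak⟩ := exists_toFunction_eq_diagOp_resolventMul (fun i => hc.ne_modeEig i)
    hc.abs_resolventMul_le v
  refine ⟨w, isWeakSolution_of_inner_eq hp (fun z => slopeBounds_nonlinearity (hs z)) fun d => ?_⟩
  rw [hweak, superpose_nonlinearity_eq hp hs, hw, hv]

end DualNonlinearity

end WaveFucik

open WaveFucik

theorem mainTheorem4 (k : ℤ) (hk : eig k ≠ 0) (a b : ℝ) (hab : (a, b) ∈ aboveD k)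
    (p : Strip → ℝ → ℝ) (hp : Continuous (Function.uncurry p))
    (hsub : SublinearAtInfinity p)
    (h1 : HypH1' k a b p) (h2 : HypH2' k a b p) (h3 : HypH3' k p) :
    ∃ w : sobolevSpace × kernelSpace, IsWeakSolution a b p w := by
  obtain ⟨habT, ε₃, ε₄, hadm, habove⟩ := hab
  obtain ⟨hR, hpos⟩ := fucikPosDef_of_mem_aboveInSquare hadm habove
  obtain ⟨ε, hε, h1⟩ := h1
  have hc := hadm.inGap
  have ha : a < eig (k + 1) - ε₃ := hR.1.2
  have hb : b < eig (k + 1) - ε₃ := hR.2.2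
  have hle := le_max_left (eig (k + 1) - ε₃) (eig (k + 1) - ε / 2)
  have hc' : InGap k (max (eig (k + 1) - ε₃) (eig (k + 1) - ε / 2)) :=
    ⟨hc.1.trans_le hle, max_lt hc.2 (by linarith)⟩
  refine exists_isWeakSolution hk hc' (ha.trans_le hle) (hb.trans_le hle)
    (hpos.mono hc ha hb hle hc' fun x hx => ?_) hp hsub hε (le_max_right _ _) h1 h2 h3
  exact max_lt_min_of_mem_squareRTilde habT ⟨hc.1.trans_le hx.1, hx.2.trans_lt hc'.2⟩
    (ha.trans_le hx.1) (hb.trans_le hx.1)
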